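/- Words are over the alphabet $A=\{0,1\}$. A right ideal of $A^*$ is a set $R\subseteq A^*$ with $RA^*\subseteq R$. It is essential if it meets every non-empty right ideal, and $R'$ is essential in $R$ if $R'$ meets every right ideal that $R$ meets. A right-ideal homomorphism is a map $\varphi:R_1\to A^*$ on a finitely generated (possibly empty) right ideal $R_1$ with $\varphi(xz)=\varphi(x)z$ for all $x\in R_1$, $z\in A^*$. An extension of $\varphi$ to a right-ideal homomorphism $\Phi$ is called essential if the domain of $\varphi$ is essential in that of $\Phi$; every $\varphi$ has a unique maximum essential extension $\max(\varphi)$, and we say that $\varphi$ represents $\max(\varphi)$. The Thompson–Higman monoid $M_{2,1}$ is the set of all $\max(\varphi)$, with multiplication $\varphi\cdot\psi=\max(\varphi\circ\psi)$. The submonoid ${\it lep}M_{2,1}$ consists of the elements represented by some right-ideal homomorphism $\varphi$ with essential domain such that $|x_1|=|x_2|$ implies $|\varphi(x_1)|=|\varphi(x_2)|$ for all $x_1,x_2\in{\rm Dom}(\varphi)$. The group ${\it lp}G_{2,1}\subseteq M_{2,1}$ consists of the maximally extended isomorphisms $\varphi$ between finitely generated essential right ideals with $|\varphi(x)|=|x|$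 for all $x\in{\rm Dom}(\varphi)$. For $1\le i<j$, $\tau_{i,j}\in{\it lep}M_{2,1}$ is the element that exchanges the $i$-th and the $j$-th letter of every word of length at least $j$; let $\tau=\{\tau_{i,j}:1\le i<j\}$. For a generating set $\Gamma$ of a monoid $M$, $|m|_\Gamma$ is the smallest length of a word over $\Gamma$ with product $m$. For a group $G\subseteq M$, the word-length asymmetry function of $G$ within $M$ over $\Gamma$ is $\lambda(n)=\max\{|g^{-1}|_\Gamma : g\in G,\ |g|_\Gamma\le n\}$ for $n\in\mathbb N$. Let $\Gamma_{M}$ be a finite generating set of $M_{2,1}$, and let $\Gamma_{\it lep}$ be a finite set such that $\Gamma_{\it lep}\cup\tau$ generates ${\it lep}M_{2,1}$. Let $\lambda_{M}$ be the word-length asymmetry function of ${\it lp}G_{2,1}$ within $M_{2,1}$ over $\Gamma_{M}\cup\tau$, and $\lambda_{\it lep}$ that of ${\it lp}G_{2,1}$ within ${\it lep}M_{2,1}$ over $\Gamma_{\it lep}\cup\tau$. **Proposition.** The maxima defining $\lambda_M(n)$ and $\lambda_{\it lep}(n)$ exist for every $n\in\mathbb N$. The functions $\lambda_M$ and $\lambda_{\it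 lep}$ are polynomially equivalent, i.e. there are positive integers $c_0,c_1,c_2,d,e$ such that for all $n\ge c_0$: $\lambda_M(n)\le c_1\,\lambda_{\it lep}(c_1n^d)^d$ and $\lambda_{\it lep}(n)\le c_2\,\lambda_M(c_2n^e)^e$. More precisely, there are positive integers $c_0,c_1,c_0',c_1'$ such that for all $n\in\mathbb N$: $$\lambda_M(n)\le c_0\,\lambda_{\it lep}(c_1n^2),\qquad \lambda_{\it lep}(n)\le c_0'\,\big(\lambda_M(c_1'n)\big)^2 .$$ -/

import Mathlib

namespace Thompson

/-- Finite words over the alphabet `{0,1}`. -/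
abbrev Word : Type := List Bool

/-- Right ideals of the free monoid `{0,1}^*`. -/
def IsRightIdeal (R : Set Word) : Prop := ∀ x ∈ R, ∀ z : Word, x ++ z ∈ R

/-- The right ideal `C {0,1}^*` generated by `C`. -/
def rightIdealOf (C : Set Word) : Set Word := {w | ∃ c ∈ C, ∃ z : Word, w = c ++ z}

/-- A finitely generated right ideal. -/
def IsFG (R : Set Word) : Prop := ∃ C : Set Word, C.Finite ∧ R = rightIdealOf C

/-- A right ideal is essential if it meets every (nonempty) right ideal. -/
def Essential (R : Set Word) : Prop :=
  ∀ I : Set Word, IsRightIdeal I → I.Nonempty → (I ∩ R).Nonempty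

/-- `R'` is essential in `R` if `R'` meets every right ideal that `R` meets. -/
def EssentialIn (R' R : Set Word) : Prop :=
  ∀ I : Set Word, IsRightIdeal I → (I ∩ R).Nonempty → (I ∩ R').Nonempty

/-- A homomorphism between finitely generated right ideals of `{0,1}^*`, as a partial function
(`none` means undefined); the empty partial function is included. -/
@[ext]
structure RIHom where
  toFun : Word → Option Word
  map_append : ∀ x y z : Word, toFun x = some y → toFun (x ++ z) = some (y ++ z)
  fg : IsFG {x | ∃ y, toFun x = some y}

namespace RIHom

def dom (f : RIHom) : Set Word := {x | ∃ y, f.toFun x = some y}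

def im (f : RIHom) : Set Word := {y | ∃ x, f.toFun x = some y}

/-- `f` is an essential restriction of `g`
(equivalently, `g` is an essential extension of `f`). -/
def EssRestr (f g : RIHom) : Prop :=
  (∀ x y, f.toFun x = some y → g.toFun x = some y) ∧ EssentialIn f.dom g.dom

/-- `f` has no proper essential extension. -/
def IsMax (f : RIHom) : Prop := ∀ g : RIHom, EssRestr f g → g = f

end RIHom

theorem isRightIdeal_principal (x : Word) : IsRightIdeal {w | ∃ z, w = x ++ z} := by
  rintro _ ⟨z, rfl⟩ t
  exact ⟨z ++ t, by simp⟩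

theorem essential_iff {R : Set Word} : Essential R ↔ ∀ x, ∃ z : Word, x ++ z ∈ R := by
  constructor
  · intro h x
    obtain ⟨_, ⟨z, rfl⟩, hw⟩ := h _ (isRightIdeal_principal x) ⟨x, [], by simp⟩
    exact ⟨z, hw⟩
  · rintro h I hI ⟨x, hx⟩
    obtain ⟨z, hz⟩ := h x
    exact ⟨x ++ z, hI x hx z, hz⟩

theorem essentialIn_iff {R' R : Set Word} :
    EssentialIn R' R ↔ ∀ x ∈ R, ∃ z : Word, x ++ z ∈ R' := by
  constructor
  · intro h x hx
    obtain ⟨_, ⟨z, rfl⟩, hw⟩ := h _ (isRightIdeal_principal x) ⟨x, ⟨[], by simp⟩, hx⟩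
    exact ⟨z, hw⟩
  · rintro h I hI ⟨x, hx, hxR⟩
    obtain ⟨z, hz⟩ := h x hxR
    exact ⟨x ++ z, hI x hx z, hz⟩

/-- A right ideal is finitely generated as soon as its members have prefixes of bounded length
in it. -/
theorem isFG_of_bounded {R : Set Word} (hR : IsRightIdeal R) (L : ℕ)
    (h : ∀ x ∈ R, ∃ c ∈ R, c.length ≤ L ∧ ∃ z, x = c ++ z) : IsFG R := by
  refine ⟨{c | c ∈ R ∧ c.length ≤ L}, ?_, ?_⟩
  · exact (List.finite_length_le Bool L).subset (fun c hc => hc.2)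
  · ext x
    constructor
    · intro hx
      obtain ⟨c, hc, hl, z, rfl⟩ := h x hx
      exact ⟨c, ⟨hc, hl⟩, z, rfl⟩
    · rintro ⟨c, hc, z, rfl⟩
      exact hR c hc.1 z

theorem IsFG.bounded {R : Set Word} (h : IsFG R) :
    ∃ L : ℕ, ∀ x ∈ R, ∃ c ∈ R, c.length ≤ L ∧ ∃ z, x = c ++ z := by
  obtain ⟨C, hC, rfl⟩ := h
  obtain ⟨L, hL⟩ := (hC.image List.length).bddAbove
  refine ⟨L, ?_⟩
  rintro x ⟨c, hc, z, rfl⟩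
  exact ⟨c, ⟨c, hc, [], by simp⟩, hL ⟨c, hc, rfl⟩, z, rfl⟩

/-- If `x z = c w` then `x` is a prefix of `c` or `c` is a prefix of `x`. -/
theorem append_cases {x z c w : Word} (h : x ++ z = c ++ w) :
    (∃ t, c = x ++ t) ∨ (∃ t, x = c ++ t) := by
  rcases List.append_eq_append_iff.1 h with ⟨t, h1, _⟩ | ⟨t, h1, _⟩
  · exact Or.inl ⟨t, h1⟩
  · exact Or.inr ⟨t, h1⟩

namespace RIHom

theorem dom_isRightIdeal (f : RIHom) : IsRightIdeal f.dom := by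
  rintro x ⟨y, hy⟩ z
  exact ⟨y ++ z, f.map_append x y z hy⟩

/-- The identity map of `{0,1}^*`. -/
def id : RIHom where
  toFun x := some x
  map_append := by
    intro x y z h
    simp_all
  fg := isFG_of_bounded (fun _ _ z => ⟨_, rfl⟩) 0
    (fun x _ => ⟨[], ⟨[], rfl⟩, by simp, x, by simp⟩)

/-- Composition of partial functions: `(f.comp g)(x) = f(g(x))`. -/
def comp (f g : RIHom) : RIHom where
  toFun x := (g.toFun x).bind f.toFun
  map_append := by
    intro x y z h
    obtain ⟨u, hu, hy⟩ := Option.bind_eq_some_iff.1 h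
    rw [g.map_append x u z hu]
    exact f.map_append u y z hy
  fg := by
    obtain ⟨L, hL⟩ := g.fg.bounded
    obtain ⟨K, hK⟩ := f.fg.bounded
    refine isFG_of_bounded ?_ (L + K) ?_
    · rintro x ⟨y, h⟩ z
      obtain ⟨u, hu, hy⟩ := Option.bind_eq_some_iff.1 h
      exact ⟨y ++ z, Option.bind_eq_some_iff.2
        ⟨u ++ z, g.map_append x u z hu, f.map_append u y z hy⟩⟩
    · rintro x ⟨y, h⟩
      obtain ⟨u, hu, hy⟩ := Option.bind_eq_some_iff.1 h
      obtain ⟨p, ⟨v, hv⟩, hpl, z, rfl⟩ := hL x ⟨u, hu⟩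
      have hu' := g.map_append p v z hv
      rw [hu] at hu'
      obtain rfl : u = v ++ z := Option.some.inj hu'
      obtain ⟨q, ⟨r, hr⟩, hql, w, hw⟩ := hK _ ⟨y, hy⟩
      rcases append_cases hw with ⟨t, rfl⟩ | ⟨t, rfl⟩
      · refine ⟨p ++ t, ⟨r, Option.bind_eq_some_iff.2 ⟨_, g.map_append p v t hv, hr⟩⟩, ?_, w, ?_⟩
        · simp only [List.length_append] at hql ⊢
          omega
        · rw [List.append_assoc] at hw
          rw [List.append_cancel_left hw, List.append_assoc]
      · exact ⟨p, ⟨r ++ t, Option.bind_eq_some_iff.2 ⟨_, hv, f.map_append q r t hr⟩⟩,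
          by omega, z, rfl⟩

theorem comp_eq_some {f g : RIHom} {x y : Word} :
    (f.comp g).toFun x = some y ↔ ∃ u, g.toFun x = some u ∧ f.toFun u = some y :=
  Option.bind_eq_some_iff

/-- The maximum essential extension of `f` takes the value `y` at `x` iff `f` is defined on an
essential part of `x {0,1}^*` and sends `x z` to `y z` whenever it is defined there. -/
def MaxVal (f : RIHom) (x y : Word) : Prop :=
  (∀ z, ∃ z' u, f.toFun (x ++ z ++ z') = some u) ∧ ∀ z u, f.toFun (x ++ z) = some u → u = y ++ z

theorem MaxVal.unique {f : RIHom} {x y y' : Word} (h : f.MaxVal x y) (h' : f.MaxVal x y') :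
    y = y' := by
  obtain ⟨z, u, hu⟩ := h.1 []
  rw [List.append_nil] at hu
  have h1 := h.2 z u hu
  rw [h'.2 z u hu] at h1
  exact (List.append_cancel_right h1).symm

theorem MaxVal.append {f : RIHom} {x y : Word} (h : f.MaxVal x y) (z : Word) :
    f.MaxVal (x ++ z) (y ++ z) := by
  constructor
  · intro t
    obtain ⟨z', u, hu⟩ := h.1 (z ++ t)
    exact ⟨z', u, by simpa using hu⟩
  · intro t u hu
    have := h.2 (z ++ t) u (by simpa using hu)
    simpa using this

theorem MaxVal.of_eq {f : RIHom} {x y : Word} (h : f.toFun x = some y) : f.MaxVal x y := by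
  constructor
  · intro z
    exact ⟨[], _, f.map_append _ _ [] (f.map_append x y z h)⟩
  · intro z u hu
    rw [f.map_append x y z h] at hu
    exact (Option.some.inj hu).symm

open Classical in
/-- The maximum essential extension. -/
noncomputable def max (f : RIHom) : RIHom where
  toFun x := if h : ∃ y, f.MaxVal x y then some h.choose else none
  map_append := by
    intro x y z h
    split_ifs at h with hx
    obtain rfl := Option.some.inj h
    have hz : ∃ y, f.MaxVal (x ++ z) y := ⟨_, hx.choose_spec.append z⟩
    rw [dif_pos hz, hz.choose_spec.unique (hx.choose_spec.append z)]
  fg := by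
    obtain ⟨L, hL⟩ := f.fg.bounded
    have key : {x | ∃ y, (if h : ∃ y, f.MaxVal x y then some h.choose else none) = some y}
        = {x | ∃ y, f.MaxVal x y} := by
      ext x
      by_cases h : ∃ y, f.MaxVal x y
      · simp [h]
      · simp [h]
    rw [key]
    refine isFG_of_bounded ?_ L ?_
    · rintro x ⟨y, h⟩ z
      exact ⟨_, h.append z⟩
    · rintro x ⟨y, h⟩
      obtain ⟨z, u, hu⟩ := h.1 []
      rw [List.append_nil] at hu
      obtain ⟨p, ⟨v, hv⟩, hpl, w, hw⟩ := hL _ ⟨u, hu⟩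
      rcases append_cases hw with ⟨t, rfl⟩ | ⟨t, rfl⟩
      · refine ⟨x, ⟨y, h⟩, ?_, [], by simp⟩
        simp only [List.length_append] at hpl
        omega
      · exact ⟨p, ⟨v, MaxVal.of_eq hv⟩, hpl, t, rfl⟩

theorem max_eq_some {f : RIHom} {x y : Word} : f.max.toFun x = some y ↔ f.MaxVal x y := by
  constructor
  · intro h
    simp only [max] at h
    split_ifs at h with hx
    obtain rfl := Option.some.inj h
    exact hx.choose_spec
  · intro h
    have hx : ∃ y, f.MaxVal x y := ⟨y, h⟩
    simp only [max]
    rw [dif_pos hx, hx.choose_spec.unique h]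

theorem ext_iff' {f g : RIHom} (h : ∀ x y, f.toFun x = some y ↔ g.toFun x = some y) : f = g := by
  ext x : 2
  exact Option.ext (fun y => h x y)

theorem essRestr_iff {f g : RIHom} : EssRestr f g ↔
    (∀ x y, f.toFun x = some y → g.toFun x = some y) ∧
      ∀ x y, g.toFun x = some y → ∃ z, f.toFun (x ++ z) = some (y ++ z) := by
  constructor
  · rintro ⟨h1, h2⟩
    refine ⟨h1, fun x y hxy => ?_⟩
    obtain ⟨z, u, hu⟩ := essentialIn_iff.1 h2 x ⟨y, hxy⟩
    refine ⟨z, ?_⟩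
    rw [hu, ← h1 _ _ hu, g.map_append x y z hxy]
  · rintro ⟨h1, h2⟩
    refine ⟨h1, essentialIn_iff.2 ?_⟩
    rintro x ⟨y, hxy⟩
    obtain ⟨z, hz⟩ := h2 x y hxy
    exact ⟨z, _, hz⟩

theorem essRestr_max (f : RIHom) : EssRestr f f.max := by
  refine essRestr_iff.2 ⟨fun x y h => max_eq_some.2 (MaxVal.of_eq h), fun x y h => ?_⟩
  have hm := max_eq_some.1 h
  obtain ⟨z, u, hu⟩ := hm.1 []
  rw [List.append_nil] at hu
  exact ⟨z, by rw [hu, hm.2 z u hu]⟩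

theorem EssRestr.max_eq {f g : RIHom} (h : EssRestr f g) : f.max = g.max := by
  obtain ⟨h1, h2⟩ := essRestr_iff.1 h
  refine ext_iff' fun x y => ?_
  rw [max_eq_some, max_eq_some]
  constructor
  · rintro ⟨ha, hb⟩
    refine ⟨fun z => ?_, fun z u hu => ?_⟩
    · obtain ⟨z', u, hu⟩ := ha z
      exact ⟨z', u, h1 _ _ hu⟩
    · obtain ⟨t, ht⟩ := h2 _ _ hu
      have := hb (z ++ t) (u ++ t) (by simpa using ht)
      rw [← List.append_assoc] at this
      exact List.append_cancel_right this
  · rintro ⟨ha, hb⟩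
    refine ⟨fun z => ?_, fun z u hu => hb z u (h1 _ _ hu)⟩
    obtain ⟨z', u, hu⟩ := ha z
    obtain ⟨t, ht⟩ := h2 _ _ hu
    exact ⟨z' ++ t, _, by simpa using ht⟩

/-- Every essential extension of `f` is a restriction of `f.max`. -/
theorem EssRestr.le_max {f g : RIHom} (h : EssRestr f g) : EssRestr g f.max := by
  rw [h.max_eq]
  exact essRestr_max g

theorem isMax_max (f : RIHom) : IsMax f.max := by
  intro g hg
  have h1 : f.max.max = f.max := (essRestr_max f).max_eq.symm
  have h2 : EssRestr g f.max := by
    have := hg.le_max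
    rwa [h1] at this
  refine ext_iff' fun x y => ⟨h2.1 x y, hg.1 x y⟩

theorem IsMax.max_eq {f : RIHom} (h : IsMax f) : f.max = f := h _ (essRestr_max f)

theorem essRestr_comp_left (f g : RIHom) : EssRestr (f.comp g) (f.max.comp g) := by
  refine essRestr_iff.2 ⟨fun x y h => ?_, fun x y h => ?_⟩
  · obtain ⟨u, hu, hy⟩ := comp_eq_some.1 h
    exact comp_eq_some.2 ⟨u, hu, (essRestr_max f).1 _ _ hy⟩
  · obtain ⟨u, hu, hy⟩ := comp_eq_some.1 h
    obtain ⟨z, hz⟩ := (essRestr_iff.1 (essRestr_max f)).2 _ _ hy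
    exact ⟨z, comp_eq_some.2 ⟨u ++ z, g.map_append _ _ z hu, hz⟩⟩

theorem essRestr_comp_right (f g : RIHom) : EssRestr (f.comp g) (f.comp g.max) := by
  refine essRestr_iff.2 ⟨fun x y h => ?_, fun x y h => ?_⟩
  · obtain ⟨u, hu, hy⟩ := comp_eq_some.1 h
    exact comp_eq_some.2 ⟨u, (essRestr_max g).1 _ _ hu, hy⟩
  · obtain ⟨u, hu, hy⟩ := comp_eq_some.1 h
    obtain ⟨z, hz⟩ := (essRestr_iff.1 (essRestr_max g)).2 _ _ hu
    exact ⟨z, comp_eq_some.2 ⟨u ++ z, hz, f.map_append _ _ z hy⟩⟩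

theorem max_comp_max_left (f g : RIHom) : (f.max.comp g).max = (f.comp g).max :=
  (essRestr_comp_left f g).max_eq.symm

theorem max_comp_max_right (f g : RIHom) : (f.comp g.max).max = (f.comp g).max :=
  (essRestr_comp_right f g).max_eq.symm

theorem comp_assoc (f g h : RIHom) : (f.comp g).comp h = f.comp (g.comp h) := by
  ext x : 2
  exact (Option.bind_assoc _ _ _).symm

theorem comp_id (f : RIHom) : f.comp id = f := rfl

theorem id_comp (f : RIHom) : id.comp f = f := by
  ext x : 2
  change (f.toFun x).bind some = f.toFun x
  cases f.toFun x <;> rfl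

end RIHom

open RIHom

/-- The Thompson–Higman monoid `M_{2,1}`: all maximally extended homomorphisms between finitely
generated right ideals of `{0,1}^*`, multiplied by composition (`f * g` is `f` after `g`)
followed by maximum essential extension. -/
def M21 : Type := {f : RIHom // IsMax f}

namespace M21

/-- The element of `M_{2,1}` represented by a right-ideal homomorphism. -/
noncomputable def mk (f : RIHom) : M21 := ⟨f.max, isMax_max f⟩

theorem mk_val (a : M21) : mk a.1 = a := Subtype.ext a.2.max_eq

noncomputable instance : Monoid M21 where
  mul a b := mk (a.1.comp b.1)
  one := mk RIHom.id
  mul_assoc a b c := by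
    refine Subtype.ext ?_
    change ((a.1.comp b.1).max.comp c.1).max = (a.1.comp (b.1.comp c.1).max).max
    rw [max_comp_max_left, max_comp_max_right, comp_assoc]
  one_mul a := by
    refine Subtype.ext ?_
    change (RIHom.id.max.comp a.1).max = a.1
    rw [max_comp_max_left, id_comp, a.2.max_eq]
  mul_one a := by
    refine Subtype.ext ?_
    change (a.1.comp RIHom.id.max).max = a.1
    rw [max_comp_max_right, comp_id, a.2.max_eq]

theorem mul_val (a b : M21) : (a * b).1 = (a.1.comp b.1).max := rfl

theorem one_val : (1 : M21).1 = RIHom.id.max := rfl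

theorem mk_mul_mk (f g : RIHom) : mk f * mk g = mk (f.comp g) := by
  refine Subtype.ext ?_
  change (f.max.comp g.max).max = (f.comp g).max
  rw [max_comp_max_left, max_comp_max_right]

end M21

/-- `f` maps words of equal length to words of equal length. -/
def LengthEqualityPreserving (f : RIHom) : Prop :=
  ∀ x₁ x₂ y₁ y₂ : Word, f.toFun x₁ = some y₁ → f.toFun x₂ = some y₂ →
    x₁.length = x₂.length → y₁.length = y₂.length

/-- The submonoid `lepM_{2,1}`: the elements represented by some length-equality preserving
right-ideal homomorphism with essential domain (that is, with domain `P {0,1}^*` for a finite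
maximal prefix code `P`). -/
noncomputable def lepM21 : Submonoid M21 where
  carrier := {a | ∃ f : RIHom, Essential f.dom ∧ LengthEqualityPreserving f ∧ M21.mk f = a}
  one_mem' := by
    refine ⟨RIHom.id, essential_iff.2 fun x => ⟨[], _, rfl⟩, ?_, rfl⟩
    intro x₁ x₂ y₁ y₂ h₁ h₂ h
    obtain rfl := Option.some.inj h₁
    obtain rfl := Option.some.inj h₂
    exact h
  mul_mem' := by
    rintro _ _ ⟨f, hf, hf', rfl⟩ ⟨g, hg, hg', rfl⟩
    refine ⟨f.comp g, essential_iff.2 fun x => ?_, ?_, (M21.mk_mul_mk f g).symm⟩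
    · obtain ⟨z, u, hu⟩ := essential_iff.1 hg x
      obtain ⟨w, v, hv⟩ := essential_iff.1 hf u
      refine ⟨z ++ w, v, comp_eq_some.2 ⟨u ++ w, ?_, hv⟩⟩
      rw [← List.append_assoc]
      exact g.map_append _ _ w hu
    · intro x₁ x₂ y₁ y₂ h₁ h₂ h
      obtain ⟨u₁, hu₁, hy₁⟩ := comp_eq_some.1 h₁
      obtain ⟨u₂, hu₂, hy₂⟩ := comp_eq_some.1 h₂
      exact hf' _ _ _ _ hy₁ hy₂ (hg' _ _ _ _ hu₁ hu₂ h)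

/-- `f` is an isomorphism between (finitely generated) essential right ideals. -/
def IsEssentialIso (f : RIHom) : Prop :=
  Essential f.dom ∧ Essential f.im ∧
    ∀ x₁ x₂ y : Word, f.toFun x₁ = some y → f.toFun x₂ = some y → x₁ = x₂

theorem comp_val_eq {a b : M21} (h : a * b = 1) {x y : Word}
    (hxy : (a.1.comp b.1).toFun x = some y) : y = x := by
  have h1 : (a.1.comp b.1).max = RIHom.id.max := congrArg Subtype.val h
  have h2 := (essRestr_max _).1 _ _ hxy
  rw [h1] at h2
  have h3 : RIHom.id.max.toFun x = some x := (essRestr_max _).1 _ _ rfl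
  rw [h3] at h2
  exact (Option.some.inj h2).symm

theorem exists_comp_val {a b : M21} (h : a * b = 1) (x : Word) :
    ∃ z u, b.1.toFun (x ++ z) = some u ∧ a.1.toFun u = some (x ++ z) := by
  have h1 : (a.1.comp b.1).max = RIHom.id.max := congrArg Subtype.val h
  have h3 : RIHom.id.max.toFun x = some x := (essRestr_max _).1 _ _ rfl
  rw [← h1] at h3
  obtain ⟨z, hz⟩ := (essRestr_iff.1 (essRestr_max _)).2 _ _ h3
  obtain ⟨u, hu, hy⟩ := comp_eq_some.1 hz
  exact ⟨z, u, hu, hy⟩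

/-- Every unit of `M_{2,1}` is an isomorphism between essential right ideals. -/
theorem isEssentialIso_unit (u : M21ˣ) : IsEssentialIso u.val.1 := by
  refine ⟨essential_iff.2 fun x => ?_, essential_iff.2 fun y => ?_, fun x₁ x₂ y h₁ h₂ => ?_⟩
  · obtain ⟨z, w, hw, -⟩ := exists_comp_val u.inv_val x
    exact ⟨z, w, hw⟩
  · obtain ⟨z, w, -, hw⟩ := exists_comp_val u.val_inv y
    exact ⟨z, w, hw⟩
  · obtain ⟨z, w, hw, hw'⟩ := exists_comp_val u.inv_val x₁
    have e₁ := u.val.1.map_append _ _ z h₁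
    have e₂ := u.val.1.map_append _ _ z h₂
    rw [hw] at e₁
    obtain rfl := Option.some.inj e₁
    have := comp_val_eq u.inv_val (comp_eq_some.2 ⟨_, e₂, hw'⟩)
    exact List.append_cancel_right this

/-- Conversely, every maximally extended isomorphism between essential right ideals is a unit of
`M_{2,1}`. -/
theorem isUnit_of_isEssentialIso (a : M21) (h : IsEssentialIso a.1) : IsUnit a := by
  classical
  obtain ⟨hd, hi, hinj⟩ := h
  have hval : ∀ x y, (if h : ∃ x, a.1.toFun x = some y then some h.choose else none) = some x ↔
      a.1.toFun x = some y := by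
    intro x y
    constructor
    · intro h
      split_ifs at h with hx
      obtain rfl := Option.some.inj h
      exact hx.choose_spec
    · intro h
      have hx : ∃ x, a.1.toFun x = some y := ⟨x, h⟩
      rw [dif_pos hx, hinj _ _ _ hx.choose_spec h]
  let g : RIHom :=
    { toFun := fun y => if h : ∃ x, a.1.toFun x = some y then some h.choose else none
      map_append := by
        intro y x z h
        exact (hval _ _).2 (a.1.map_append _ _ z ((hval _ _).1 h))
      fg := by
        have key : {y | ∃ x, (if h : ∃ x, a.1.toFun x = some y then some h.choose else none)
            = some x} = a.1.im := by
          ext y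
          exact exists_congr fun x => hval x y
        rw [key]
        obtain ⟨C, hC, hC'⟩ := a.1.fg
        refine ⟨{y | ∃ c ∈ C, a.1.toFun c = some y}, ?_, ?_⟩
        · refine (hC.image fun c => (a.1.toFun c).getD []).subset ?_
          rintro y ⟨c, hc, hy⟩
          exact ⟨c, hc, by simp [hy]⟩
        · ext y
          constructor
          · rintro ⟨x, hx⟩
            have hx' : x ∈ rightIdealOf C := hC' ▸ (⟨y, hx⟩ : x ∈ {x | ∃ y, a.1.toFun x = some y})
            obtain ⟨c, hc, z, rfl⟩ := hx'
            have hcd : c ∈ {x | ∃ y, a.1.toFun x = some y} := by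
              rw [hC']
              exact ⟨c, hc, [], by simp⟩
            obtain ⟨v, hv⟩ := hcd
            refine ⟨v, ⟨c, hc, hv⟩, z, ?_⟩
            rw [a.1.map_append _ _ z hv] at hx
            exact (Option.some.inj hx).symm
          · rintro ⟨v, ⟨c, hc, hv⟩, z, rfl⟩
            exact ⟨c ++ z, a.1.map_append _ _ z hv⟩ }
  have hg : ∀ x y, g.toFun y = some x ↔ a.1.toFun x = some y := hval
  have h1 : a * M21.mk g = 1 := by
    rw [← M21.mk_val a, M21.mk_mul_mk]
    refine Subtype.ext (EssRestr.max_eq (essRestr_iff.2 ⟨fun x y h => ?_, fun x y h => ?_⟩))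
    · obtain ⟨u, hu, hy⟩ := comp_eq_some.1 h
      exact ((hg _ _).1 hu).symm.trans hy
    · obtain rfl := Option.some.inj h
      obtain ⟨z, w, hw⟩ := essential_iff.1 hi x
      exact ⟨z, comp_eq_some.2 ⟨w, (hg _ _).2 hw, hw⟩⟩
  have h2 : M21.mk g * a = 1 := by
    rw [← M21.mk_val a, M21.mk_mul_mk]
    refine Subtype.ext (EssRestr.max_eq (essRestr_iff.2 ⟨fun x y h => ?_, fun x y h => ?_⟩))
    · obtain ⟨u, hu, hy⟩ := comp_eq_some.1 h
      exact congrArg some (hinj _ _ _ hu ((hg _ _).1 hy))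
    · obtain rfl := Option.some.inj h
      obtain ⟨z, w, hw⟩ := essential_iff.1 hd x
      exact ⟨z, comp_eq_some.2 ⟨w, hw, (hg _ _).2 hw⟩⟩
  exact ⟨⟨a, M21.mk g, h1, h2⟩, rfl⟩

/-- `f` preserves length: `|f(x)| = |x|` for all `x` in the domain. -/
def LengthPreserving (f : RIHom) : Prop :=
  ∀ x y : Word, f.toFun x = some y → x.length = y.length

/-- The group `lpG_{2,1}` of length-preserving elements of the Thompson group `G_{2,1}`, inside the
group of units of `M_{2,1}`. The elements of `G_{2,1}` are the maximally extended isomorphisms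
between finitely generated essential right ideals of `{0,1}^*`. -/
def lpG21 : Subgroup M21ˣ where
  carrier := {u | IsEssentialIso u.val.1 ∧ LengthPreserving u.val.1}
  one_mem' := by
    refine ⟨isEssentialIso_unit 1, fun x y h => ?_⟩
    have h3 : RIHom.id.max.toFun x = some x := (essRestr_max _).1 _ _ rfl
    have h4 : RIHom.id.max.toFun x = some y := h
    rw [h3] at h4
    rw [Option.some.inj h4]
  mul_mem' := by
    rintro u v ⟨-, hu⟩ ⟨-, hv⟩
    refine ⟨isEssentialIso_unit _, fun x y h => ?_⟩
    obtain ⟨z, hz⟩ := (essRestr_iff.1 (essRestr_max (u.val.1.comp v.val.1))).2 x y h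
    obtain ⟨w, hw, hy⟩ := comp_eq_some.1 hz
    have := (hv _ _ hw).trans (hu _ _ hy)
    simpa using this
  inv_mem' := by
    rintro u ⟨-, hu⟩
    refine ⟨isEssentialIso_unit _, fun y x h => ?_⟩
    have h' : u.inv.1.toFun y = some x := h
    obtain ⟨z, w, hw, hy⟩ := exists_comp_val u.val_inv y
    rw [u.inv.1.map_append _ _ z h'] at hw
    obtain rfl := Option.some.inj hw
    have := hu _ _ hy
    simpa using this.symm

/-- The map exchanging the letters at the (0-based) positions `i` and `j` of a word, defined on
all words that are long enough. -/
def swapHom (i j : ℕ) : RIHom where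
  toFun x := if i < x.length ∧ j < x.length then
    some ((x.set i (x.getD j false)).set j (x.getD i false)) else none
  map_append := by
    intro x y z h
    split_ifs at h with hx
    obtain rfl := Option.some.inj h
    obtain ⟨hi, hj⟩ := hx
    rw [if_pos (by simp; omega)]
    rw [List.getD_append _ _ _ _ hi, List.getD_append _ _ _ _ hj,
      List.set_append_left _ _ hi, List.set_append_left _ _ (by simpa using hj)]
  fg := by
    refine isFG_of_bounded ?_ (Max.max i j + 1) ?_
    · rintro x ⟨y, h⟩ z
      split_ifs at h with hx
      exact ⟨_, if_pos (by simp; omega)⟩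
    · rintro x ⟨y, h⟩
      split_ifs at h with hx
      refine ⟨x.take (Max.max i j + 1), ⟨_, if_pos ?_⟩, by simp, x.drop (Max.max i j + 1), by simp⟩
      simp
      omega

/-- The bit transpositions `τ_{i,j}`, for all pairs of positions `i < j`, as elements of
`M_{2,1}`. -/
def bitTranspositions : Set M21 := {t | ∃ i j : ℕ, i < j ∧ t = M21.mk (swapHom i j)}

end Thompson

/-- Word-length over `Γ`: the length of a shortest product of elements of `Γ` equal to `m`
(meaningful when `m` lies in the submonoid generated by `Γ`; the identity has length `0`). -/
noncomputable def wordLength {M : Type*} [Monoid M] (Γ : Set M) (m : M) : ℕ :=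
  sInf {k | ∃ l : List M, (∀ γ ∈ l, γ ∈ Γ) ∧ l.prod = m ∧ l.length = k}

/-- The set `{|g⁻¹|_Γ : |g|_Γ ≤ n, g ∈ G}`, for a group `G` of units. -/
def asymmetrySet {M : Type*} [Monoid M] (G : Subgroup Mˣ) (Γ : Set M) (n : ℕ) : Set ℕ :=
  {k | ∃ g ∈ G, wordLength Γ (g : M) ≤ n ∧ wordLength Γ ((g⁻¹ : Mˣ) : M) = k}

/-- The word-length asymmetry function `λ(n) = max {|g⁻¹|_Γ : |g|_Γ ≤ n, g ∈ G}` of `G` within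
the monoid generated by `Γ`. -/
noncomputable def asymmetry {M : Type*} [Monoid M] (G : Subgroup Mˣ) (Γ : Set M) (n : ℕ) : ℕ :=
  sSup (asymmetrySet G Γ n)

/-- Polynomial equivalence of functions `ℕ → ℕ`. -/
def PolyEquiv (f₁ f₂ : ℕ → ℕ) : Prop :=
  ∃ c₀ c₁ c₂ d e : ℕ, 0 < c₀ ∧ 0 < c₁ ∧ 0 < c₂ ∧ 0 < d ∧ 0 < e ∧
    ∀ n ≥ c₀, f₁ n ≤ c₁ * f₂ (c₁ * n ^ d) ^ d ∧ f₂ n ≤ c₂ * f₁ (c₂ * n ^ e) ^ e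

/-!
A product of `n` generators is simulated by length-preserving operations. The words of a large
length `m` are written on a tape behind `O(n)` padding bits, and a register of `O(n)` bits, exactly
one of which is set, records where on the tape the current word starts. A generator changes only a
bounded prefix of a word, or is a transposition of two letters; so it is simulated by sweeping over
the `O(n)` possible starting points and applying at each of them an operation that reads and writes
boundedly many bits, and such an operation is a conjugate of a fixed element of `lepM_{2,1}` by
boundedly many transpositions. If the product is length-preserving, the word finally returns to its
original place and the padding can be removed, which gives the bound `O(n * n)` on the word-length.

The simulation also shows that such a product changes only letters at a number of positions that is
bounded in terms of `n`. An injective one therefore has orbits of bounded length, so its inverse is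
a power of it with bounded exponent, and the maxima exist.
-/

section WordLength

variable {M : Type*} [Monoid M] {Γ Δ : Set M} {a b : M}

theorem exists_list_length_eq_wordLength (ha : a ∈ Submonoid.closure Γ) :
    ∃ l : List M, (∀ γ ∈ l, γ ∈ Γ) ∧ l.prod = a ∧ l.length = wordLength Γ a := by
  obtain ⟨l, hl, hprod⟩ := Submonoid.exists_list_of_mem_closure ha
  exact Nat.sInf_mem (s := {k | ∃ l : List M, (∀ γ ∈ l, γ ∈ Γ) ∧ l.prod = a ∧ l.length = k})
    ⟨l.length, l, hl, hprod, rfl⟩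

theorem wordLength_prod_le {l : List M} (hl : ∀ γ ∈ l, γ ∈ Γ) : wordLength Γ l.prod ≤ l.length :=
  Nat.sInf_le ⟨l, hl, rfl, rfl⟩

theorem wordLength_one (Γ : Set M) : wordLength Γ 1 = 0 :=
  Nat.le_zero.1 (wordLength_prod_le (l := []) (by simp))

theorem wordLength_le_one_of_mem (ha : a ∈ Γ) : wordLength Γ a ≤ 1 := by
  simpa using wordLength_prod_le (l := [a]) (by simpa using ha)

theorem eq_one_of_wordLength_eq_zero (ha : a ∈ Submonoid.closure Γ) (h : wordLength Γ a = 0) :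
    a = 1 := by
  obtain ⟨l, -, rfl, hl⟩ := exists_list_length_eq_wordLength ha
  rw [List.length_eq_zero_iff.1 (hl.trans h), List.prod_nil]

theorem wordLength_mul_le (ha : a ∈ Submonoid.closure Γ) (hb : b ∈ Submonoid.closure Γ) :
    wordLength Γ (a * b) ≤ wordLength Γ a + wordLength Γ b := by
  obtain ⟨l, hl, rfl, hla⟩ := exists_list_length_eq_wordLength ha
  obtain ⟨l', hl', rfl, hlb⟩ := exists_list_length_eq_wordLength hb
  rw [← hla, ← hlb, ← List.prod_append, ← List.length_append]
  exact wordLength_prod_le (List.forall_mem_append.2 ⟨hl, hl'⟩)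

theorem wordLength_pow_le (ha : a ∈ Submonoid.closure Γ) (k : ℕ) :
    wordLength Γ (a ^ k) ≤ k * wordLength Γ a := by
  induction k with
  | zero => simp [wordLength_one]
  | succ k ih =>
    rw [pow_succ, Nat.succ_mul]
    exact (wordLength_mul_le (pow_mem ha k) ha).trans (Nat.add_le_add_right ih _)

theorem wordLength_le_mul_wordLength {B : ℕ} (hΓ : Γ ⊆ Submonoid.closure Δ)
    (hB : ∀ γ ∈ Γ, wordLength Δ γ ≤ B) (ha : a ∈ Submonoid.closure Γ) :
    wordLength Δ a ≤ B * wordLength Γ a := by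
  obtain ⟨l, hl, rfl, hla⟩ := exists_list_length_eq_wordLength ha
  rw [← hla]
  clear hla ha
  induction l with
  | nil => simp [wordLength_one]
  | cons γ l ih =>
    obtain ⟨hγ, hl⟩ := List.forall_mem_cons.1 hl
    have hprod : l.prod ∈ Submonoid.closure Δ := list_prod_mem fun δ hδ => hΓ (hl δ hδ)
    calc wordLength Δ (γ :: l).prod ≤ wordLength Δ γ + wordLength Δ l.prod := by
          rw [List.prod_cons]
          exact wordLength_mul_le (hΓ hγ) hprod
      _ ≤ B + B * l.length := add_le_add (hB γ hγ) (ih hl)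
      _ = B * (γ :: l).length := by rw [List.length_cons]; ring

theorem exists_wordLength_union_le_mul {T : Set M} (hΓ : Γ.Finite)
    (hΓΔ : Γ ⊆ Submonoid.closure (Δ ∪ T)) :
    ∃ B : ℕ, 0 < B ∧ ∀ a ∈ Submonoid.closure (Γ ∪ T),
      wordLength (Δ ∪ T) a ≤ B * wordLength (Γ ∪ T) a := by
  obtain ⟨B, hB⟩ := (hΓ.image (wordLength (Δ ∪ T))).bddAbove
  refine ⟨B + 1, B.succ_pos, fun a ha => wordLength_le_mul_wordLength ?_ ?_ ha⟩
  · exact Set.union_subset hΓΔ (Set.subset_union_right.trans Submonoid.subset_closure)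
  · rintro γ (hγ | hγ)
    · exact (hB ⟨γ, hγ, rfl⟩).trans B.le_succ
    · exact (wordLength_le_one_of_mem (Set.mem_union_right Δ hγ)).trans (Nat.le_add_left 1 B)

end WordLength

section Asymmetry

variable {M : Type*} [Monoid M] {G : Subgroup Mˣ} {Γ Δ : Set M}

theorem isGreatest_asymmetry {n : ℕ} (h : BddAbove (asymmetrySet G Γ n)) :
    IsGreatest (asymmetrySet G Γ n) (asymmetry G Γ n) :=
  ⟨Nat.sSup_mem ⟨0, 1, one_mem G, by simp [wordLength_one], by simp [wordLength_one]⟩ h,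
    fun _ hk => le_csSup h hk⟩

theorem asymmetry_mono (h : ∀ n, BddAbove (asymmetrySet G Γ n)) : Monotone (asymmetry G Γ) := by
  intro m n hmn
  obtain ⟨g, hg, hgm, hg'⟩ := (isGreatest_asymmetry (h m)).1
  exact (isGreatest_asymmetry (h n)).2 ⟨g, hg, hgm.trans hmn, hg'⟩

theorem bddAbove_asymmetrySet_of_pow_eq_one {n k : ℕ} (hk : 0 < k)
    (hmem : ∀ g ∈ G, (g : M) ∈ Submonoid.closure Γ)
    (hpow : ∀ g ∈ G, wordLength Γ (g : M) ≤ n → g ^ k = 1) : BddAbove (asymmetrySet G Γ n) := by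
  refine ⟨k * n, ?_⟩
  rintro _ ⟨g, hg, hgn, rfl⟩
  have hinv : g⁻¹ = g ^ (k - 1) :=
    inv_eq_of_mul_eq_one_right (by rw [mul_pow_sub_one hk.ne', hpow g hg hgn])
  rw [hinv, Units.val_pow_eq_pow_val]
  exact (wordLength_pow_le (hmem g hg) _).trans (Nat.mul_le_mul (Nat.sub_le k 1) hgn)

theorem asymmetry_le_mul_pow {B C d e : ℕ} (hΓ : ∀ n, BddAbove (asymmetrySet G Γ n))
    (hΔ : ∀ n, BddAbove (asymmetrySet G Δ n))
    (hΓΔ : ∀ g ∈ G, wordLength Γ (g : M) ≤ C * wordLength Δ (g : M) ^ d)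
    (hΔΓ : ∀ g ∈ G, wordLength Δ (g : M) ≤ B * wordLength Γ (g : M) ^ e) (n : ℕ) :
    asymmetry G Δ n ≤ B * asymmetry G Γ (C * n ^ d) ^ e := by
  obtain ⟨g, hg, hgn, hg'⟩ := (isGreatest_asymmetry (hΔ n)).1
  have hgΓ : wordLength Γ (g : M) ≤ C * n ^ d := (hΓΔ g hg).trans (by gcongr)
  have hinv : wordLength Γ ((g⁻¹ : Mˣ) : M) ≤ asymmetry G Γ (C * n ^ d) :=
    (isGreatest_asymmetry (hΓ _)).2 ⟨g, hg, hgΓ, rfl⟩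
  rw [← hg']
  exact (hΔΓ _ (inv_mem hg)).trans (by gcongr)

end Asymmetry

theorem le_mul_pow_of_le_mul_pow {f g : ℕ → ℕ} (hg : Monotone g) {a b c d p q : ℕ} (hp : 0 < p)
    (hq : 0 < q) (hpd : p ≤ d) (hqd : q ≤ d) (ha : a ≤ c) (hb : b ≤ c)
    (h : ∀ n, f n ≤ a * g (b * n ^ p) ^ q) (n : ℕ) : f n ≤ c * g (c * n ^ d) ^ d := by
  have pow_le_pow {x i j : ℕ} (hi : 0 < i) (hij : i ≤ j) : x ^ i ≤ x ^ j := by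
    rcases Nat.eq_zero_or_pos x with rfl | hx
    · rw [zero_pow hi.ne']
      exact Nat.zero_le _
    · exact Nat.pow_le_pow_right hx hij
  calc f n ≤ a * g (b * n ^ p) ^ q := h n
    _ ≤ c * g (c * n ^ d) ^ q := by gcongr; exact hg (Nat.mul_le_mul hb (pow_le_pow hp hpd))
    _ ≤ c * g (c * n ^ d) ^ d := Nat.mul_le_mul_left c (pow_le_pow hq hqd)

theorem polyEquiv_of_le_mul_pow {f g : ℕ → ℕ} (hf : Monotone f) (hg : Monotone g)
    {a b p q a' b' p' q' : ℕ} (hp : 0 < p) (hq : 0 < q) (hp' : 0 < p') (hq' : 0 < q')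
    (hfg : ∀ n, f n ≤ a * g (b * n ^ p) ^ q) (hgf : ∀ n, g n ≤ a' * f (b' * n ^ p') ^ q') :
    PolyEquiv f g :=
  ⟨1, a + b + 1, a' + b' + 1, p + q, p' + q', one_pos, by omega, by omega, by omega, by omega,
    fun n _ =>
      ⟨le_mul_pow_of_le_mul_pow hg hp hq (by omega) (by omega) (by omega) (by omega) hfg n,
        le_mul_pow_of_le_mul_pow hf hp' hq' (by omega) (by omega) (by omega) (by omega) hgf n⟩⟩

namespace Thompson

open RIHom Filter

theorem Essential.eventually_mem {R : Set Word} (h : Essential R) (hR : IsRightIdeal R)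
    (hfg : IsFG R) : ∀ᶠ m in atTop, ∀ x : Word, x.length = m → x ∈ R := by
  obtain ⟨L, hL⟩ := hfg.bounded
  filter_upwards [eventually_ge_atTop L] with m hm x hx
  obtain ⟨z, hz⟩ := essential_iff.1 h x
  obtain ⟨c, hc, hcL, w, hw⟩ := hL _ hz
  rcases append_cases hw with ⟨t, rfl⟩ | ⟨t, rfl⟩
  · rw [List.length_append] at hcL
    obtain rfl : t = [] := List.length_eq_zero_iff.1 (by omega)
    rwa [List.append_nil] at hc
  · exact hR c hc t

namespace M21

theorem mk_apply {f : RIHom} {x y : Word} (h : f.toFun x = some y) : (mk f).1.toFun x = some y :=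
  (essRestr_max f).1 _ _ h

theorem mul_apply {a b : M21} {x y z : Word} (hb : b.1.toFun x = some y)
    (ha : a.1.toFun y = some z) : (a * b).1.toFun x = some z :=
  mk_apply (comp_eq_some.2 ⟨y, hb, ha⟩)

theorem one_apply (x : Word) : (1 : M21).1.toFun x = some x :=
  mk_apply (f := RIHom.id) rfl

theorem ext_of_length_eq {a b : M21} (m : ℕ)
    (h : ∀ x : Word, x.length = m → ∃ y, a.1.toFun x = some y ∧ b.1.toFun x = some y) : a = b := by
  have agree : ∀ x : Word, m ≤ x.length → ∃ y, a.1.toFun x = some y ∧ b.1.toFun x = some y := by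
    intro x hx
    obtain ⟨y, ha, hb⟩ := h (x.take m) (List.length_take_of_le hx)
    rw [← List.take_append_drop m x]
    exact ⟨_, a.1.map_append _ _ _ ha, b.1.map_append _ _ _ hb⟩
  have extends_of_agree {a b : M21}
      (hab : ∀ x : Word, m ≤ x.length → ∃ y, a.1.toFun x = some y ∧ b.1.toFun x = some y)
      {x y : Word} (hxy : a.1.toFun x = some y) : b.1.toFun x = some y := by
    rw [← b.2.max_eq, max_eq_some]
    have hab' (z : Word) := hab (x ++ z ++ List.replicate m false) (by simp; omega)
    refine ⟨fun z => ?_, fun z u hu => ?_⟩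
    · obtain ⟨v, -, hv⟩ := hab' z
      exact ⟨_, v, hv⟩
    · obtain ⟨v, hav, hbv⟩ := hab' z
      rw [b.1.map_append _ _ _ hu, Option.some_inj] at hbv
      rw [a.1.map_append _ _ _ (a.1.map_append _ _ z hxy), Option.some_inj] at hav
      exact List.append_cancel_right (hbv.trans hav.symm)
  refine Subtype.ext (ext_iff' fun x y => ⟨extends_of_agree agree, extends_of_agree ?_⟩)
  exact fun x hx => (agree x hx).imp fun _ => And.symm

end M21

theorem mem_lepM21_of_mem_lpG21 {u : M21ˣ} (hu : u ∈ lpG21) : (u : M21) ∈ lepM21 :=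
  ⟨u.val.1, hu.1.1, fun _ _ _ _ h₁ h₂ h => by rw [← hu.2 _ _ h₁, ← hu.2 _ _ h₂, h], M21.mk_val u⟩

/-- The word `s 0, …, s (T - 1)`. Words are handled as initial segments of infinite sequences, so
that letters can be moved by permutations of `ℕ`. -/
def bits (T : ℕ) (s : ℕ → Bool) : Word := (List.range T).map s

@[simp]
theorem length_bits (T : ℕ) (s : ℕ → Bool) : (bits T s).length = T := by simp [bits]

theorem getD_bits {T t : ℕ} (s : ℕ → Bool) (h : t < T) : (bits T s).getD t false = s t := by
  simp [bits, h]

theorem bits_congr {T : ℕ} {s s' : ℕ → Bool} (h : ∀ t < T, s t = s' t) : bits T s = bits T s' :=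
  List.map_congr_left fun t ht => h t (List.mem_range.1 ht)

theorem bits_getD (x : Word) : bits x.length (fun t => x.getD t false) = x := by
  refine List.ext_getElem (length_bits _ _) fun i _ hi => ?_
  simp [bits, hi]

theorem bits_add (a b : ℕ) (s : ℕ → Bool) :
    bits (a + b) s = bits a s ++ bits b fun t => s (a + t) := by
  simp [bits, List.range_add, Function.comp_def]

theorem M21.ext_bits {a b : M21} (m : ℕ)
    (h : ∀ s, ∃ y, a.1.toFun (bits m s) = some y ∧ b.1.toFun (bits m s) = some y) : a = b :=
  M21.ext_of_length_eq m fun x hx => by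
    rw [← bits_getD x, hx]
    exact h _

theorem swapHom_bits {i j T : ℕ} (hi : i < T) (hj : j < T) (s : ℕ → Bool) :
    (swapHom i j).toFun (bits T s) = some (bits T fun t => s (Equiv.swap i j t)) := by
  simp only [swapHom, length_bits, hi, hj, and_self, if_true, getD_bits, Option.some_inj]
  refine List.ext_getElem (by simp) fun t _ _ => ?_
  simp only [bits, List.getElem_set, List.getElem_map, List.getElem_range, Equiv.swap_apply_def]
  grind

/-- The partial function that replaces the prefix `r` of length `d` of a word by `φ r`. -/
def prefixHom (d : ℕ) (φ : Word → Word) : RIHom where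
  toFun x := if d ≤ x.length then some (φ (x.take d) ++ x.drop d) else none
  map_append := by
    intro x y z h
    split_ifs at h with hx
    obtain rfl := Option.some.inj h
    rw [if_pos (hx.trans (by simp)), List.take_append_of_le_length hx,
      List.drop_append_of_le_length hx, List.append_assoc]
  fg := by
    refine isFG_of_bounded ?_ d ?_
    · rintro x ⟨y, h⟩ z
      split_ifs at h with hx
      exact ⟨_, if_pos (hx.trans (by simp))⟩
    · rintro x ⟨y, h⟩
      split_ifs at h with hx
      exact ⟨x.take d, ⟨_, if_pos (by simp [hx])⟩, by simp, x.drop d, by simp⟩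

theorem prefixHom_append {d : ℕ} {φ : Word → Word} {x z : Word} (h : x.length = d) :
    (prefixHom d φ).toFun (x ++ z) = some (φ x ++ z) := by
  subst h
  simp [prefixHom]

theorem mk_prefixHom_mem_lepM21 {d e : ℕ} {φ : Word → Word}
    (h : ∀ r, r.length = d → (φ r).length = e) : M21.mk (prefixHom d φ) ∈ lepM21 := by
  refine ⟨prefixHom d φ, essential_iff.2 fun x => ⟨List.replicate d false, _, if_pos (by simp)⟩,
    fun x₁ x₂ y₁ y₂ h₁ h₂ hx => ?_, rfl⟩
  simp only [prefixHom] at h₁ h₂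
  split_ifs at h₁ h₂ with hx₁ hx₂
  obtain rfl := Option.some.inj h₁
  obtain rfl := Option.some.inj h₂
  rw [List.length_append, List.length_append, h _ (List.length_take_of_le hx₁),
    h _ (List.length_take_of_le hx₂), List.length_drop, List.length_drop, hx]

/-- Some element of word-length at most `k` over `Γ` maps `bits T s` to `bits T' (f s)`, for
all `s`. -/
def Realizes (Γ : Set M21) (T T' k : ℕ) (f : (ℕ → Bool) → ℕ → Bool) : Prop :=
  ∃ a ∈ Submonoid.closure Γ, wordLength Γ a ≤ k ∧
    ∀ s, a.1.toFun (bits T s) = some (bits T' (f s))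

namespace Realizes

variable {Γ : Set M21} {T T' T'' k k' : ℕ} {f f' : (ℕ → Bool) → ℕ → Bool}

theorem id (Γ : Set M21) (T k : ℕ) : Realizes Γ T T k fun s => s :=
  ⟨1, one_mem _, by simp [wordLength_one], fun _ => M21.one_apply _⟩

theorem comp (h' : Realizes Γ T' T'' k' f') (h : Realizes Γ T T' k f) :
    Realizes Γ T T'' (k' + k) fun s => f' (f s) := by
  obtain ⟨a, ha, hk, hf⟩ := h
  obtain ⟨b, hb, hk', hf'⟩ := h'
  exact ⟨b * a, mul_mem hb ha, (wordLength_mul_le hb ha).trans (add_le_add hk' hk),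
    fun s => M21.mul_apply (hf s) (hf' _)⟩

theorem mono (h : Realizes Γ T T' k f) (hk : k ≤ k') : Realizes Γ T T' k' f := by
  obtain ⟨a, ha, hak, hf⟩ := h
  exact ⟨a, ha, hak.trans hk, hf⟩

theorem congr (h : Realizes Γ T T' k f) (hf : ∀ s, ∀ t < T', f s t = f' s t) :
    Realizes Γ T T' k f' := by
  obtain ⟨a, ha, hak, haf⟩ := h
  exact ⟨a, ha, hak, fun s => by rw [haf s, bits_congr (hf s)]⟩

theorem exists_sweep {op : ℕ → (ℕ → Bool) → ℕ → Bool} (B : ℕ)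
    (h : ∀ β < B, Realizes Γ T T k (op β)) :
    ∃ op', Realizes Γ T T (k * B) op' ∧
      ∀ s s' b, (∀ β < B, β ≠ b → op β s = s) → (∀ β < B, op β s' = s') → op b s = s' →
        op' s = if b < B then s' else s := by
  induction B with
  | zero => exact ⟨_, id Γ T _, fun _ _ _ _ _ _ => rfl⟩
  | succ B ih =>
    obtain ⟨op', hop', hsweep⟩ := ih fun β hβ => h β (hβ.trans B.lt_succ_self)
    refine ⟨_, ((h B B.lt_succ_self).comp hop').mono (by rw [Nat.mul_succ, add_comm]), ?_⟩
    intro s s' b hs hs' hb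
    rw [hsweep s s' b (fun β hβ => hs β (hβ.trans B.lt_succ_self))
      (fun β hβ => hs' β (hβ.trans B.lt_succ_self)) hb]
    rcases lt_trichotomy b B with h | rfl | h
    · rw [if_pos h, if_pos (h.trans B.lt_succ_self), hs' B B.lt_succ_self]
    · rw [if_neg b.lt_irrefl, if_pos b.lt_succ_self, hb]
    · rw [if_neg h.not_gt, if_neg (by omega), hs B B.lt_succ_self h.ne]

end Realizes

theorem realizes_swap {Γ : Set M21} (hτ : bitTranspositions ⊆ Γ) {i j T : ℕ} (hi : i < T)
    (hj : j < T) : Realizes Γ T T 1 fun s t => s (Equiv.swap i j t) := by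
  wlog hij : i < j generalizing i j
  · rcases (not_lt.1 hij).eq_or_lt with rfl | hji
    · simpa using Realizes.id Γ T 1
    · simpa only [Equiv.swap_comm] using this hj hi hji
  have hmem : M21.mk (swapHom i j) ∈ Γ := hτ ⟨i, j, hij, rfl⟩
  exact ⟨_, Submonoid.subset_closure hmem, wordLength_le_one_of_mem hmem,
    fun s => M21.mk_apply (swapHom_bits hi hj s)⟩

theorem le_of_injective_of_lt {d T : ℕ} {π : Fin d → ℕ} (hπ : Function.Injective π)
    (hπT : ∀ j, π j < T) : d ≤ T := by
  simpa using Fintype.card_le_of_injective (fun j => (⟨π j, hπT j⟩ : Fin T))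
    fun i j h => hπ (congrArg Fin.val h)

theorem exists_perm_realizes {Γ : Set M21} (hτ : bitTranspositions ⊆ Γ) {T d : ℕ}
    (π : Fin d → ℕ) (hπ : Function.Injective π) (hπT : ∀ j, π j < T) :
    ∃ σ : Equiv.Perm ℕ, (∀ j : Fin d, σ j = π j) ∧ (∀ t < T, σ t < T) ∧
      Realizes Γ T T d (fun s t => s (σ t)) ∧ Realizes Γ T T d fun s t => s (σ.symm t) := by
  induction d with
  | zero => exact ⟨1, fun j => j.elim0, fun _ ht => ht, Realizes.id Γ T 0, Realizes.id Γ T 0⟩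
  | succ d ih =>
    obtain ⟨σ, hσπ, hσT, hσ, hσ'⟩ := ih (fun j => π j.castSucc)
      (hπ.comp (Fin.castSucc_injective d)) fun j => hπT _
    have hσd : σ d < T := hσT d (le_of_injective_of_lt hπ hπT)
    have hswap := realizes_swap hτ hσd (hπT (Fin.last d))
    refine ⟨σ.trans (Equiv.swap (σ d) (π (Fin.last d))), fun j => ?_, fun t ht => ?_, ?_, ?_⟩
    · induction j using Fin.lastCases with
      | last => simp
      | cast j =>
        have hσj : σ j = π j.castSucc := hσπ j
        rw [Fin.val_castSucc, Equiv.trans_apply, hσj, Equiv.swap_apply_of_ne_of_ne]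
        · exact hσj ▸ σ.injective.ne j.2.ne
        · exact hπ.ne (Fin.castSucc_lt_last j).ne
    · rw [Equiv.trans_apply, Equiv.swap_apply_def]
      split_ifs
      exacts [hπT _, hσd, hσT t ht]
    · exact hσ.comp hswap
    · exact (hswap.comp hσ').mono (by omega)

section LocalOp

variable {κ : Type*} {φ : (κ → Bool) → κ → Bool} {π : κ → ℕ}

/-- The operation on sequences of bits that applies `φ` to the bits at the positions `π`. -/
noncomputable def localOp (φ : (κ → Bool) → κ → Bool) (π : κ → ℕ) (s : ℕ → Bool) : ℕ → Bool :=
  Function.extend π (φ (s ∘ π)) s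

theorem localOp_apply (hπ : Function.Injective π) (s : ℕ → Bool) (k : κ) :
    localOp φ π s (π k) = φ (s ∘ π) k :=
  hπ.extend_apply _ _ _

theorem localOp_apply_of_forall_ne (s : ℕ → Bool) {t : ℕ} (h : ∀ k, π k ≠ t) :
    localOp φ π s t = s t :=
  Function.extend_apply' _ _ _ fun ⟨k, hk⟩ => h k hk

theorem localOp_eq (hπ : Function.Injective π) {s s' : ℕ → Bool}
    (h : ∀ k, φ (s ∘ π) k = s' (π k)) (h' : ∀ t, (∀ k, π k ≠ t) → s t = s' t) :
    localOp φ π s = s' := by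
  funext t
  by_cases ht : ∃ k, π k = t
  · obtain ⟨k, rfl⟩ := ht
    rw [localOp_apply hπ, h]
  · rw [localOp_apply_of_forall_ne s (not_exists.1 ht), h' t (not_exists.1 ht)]

theorem localOp_eq_self (hπ : Function.Injective π) {s : ℕ → Bool} (h : φ (s ∘ π) = s ∘ π) :
    localOp φ π s = s :=
  localOp_eq hπ (fun k => congrFun h k) fun _ _ => rfl

theorem localOp_perm_comp (hπ : Function.Injective π) (σ : Equiv.Perm ℕ) (s : ℕ → Bool) :
    localOp φ (σ ∘ π) s = fun t => localOp φ π (s ∘ σ) (σ.symm t) := by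
  refine localOp_eq (σ.injective.comp hπ) (fun k => ?_) fun t ht => ?_
  · rw [Function.comp_apply, Equiv.symm_apply_apply, localOp_apply hπ, Function.comp_assoc]
  · rw [localOp_apply_of_forall_ne, Function.comp_apply, Equiv.apply_symm_apply]
    exact fun k hk => ht k (by rw [Function.comp_apply, hk, Equiv.apply_symm_apply])

end LocalOp

/-- The sequence `s` preceded by `n` letters `0`. -/
def padLeft (n : ℕ) (s : ℕ → Bool) : ℕ → Bool := fun t => if t < n then false else s (t - n)

section Generators

variable {Γ : Set M21}

theorem exists_realizes_prefix (hlep : lepM21 ≤ Submonoid.closure Γ) {d e : ℕ} {φ : Word → Word}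
    (h : ∀ r, r.length = d → (φ r).length = e) :
    ∃ K, ∀ t (f : (ℕ → Bool) → ℕ → Bool),
      (∀ s, bits e (f s) = φ (bits d s)) → (∀ s t, f s (e + t) = s (d + t)) →
      Realizes Γ (d + t) (e + t) K f := by
  refine ⟨_, fun t f hφ htail => ⟨_, hlep (mk_prefixHom_mem_lepM21 h), le_rfl, fun s => ?_⟩⟩
  refine M21.mk_apply ?_
  rw [bits_add, bits_add, prefixHom_append (length_bits _ _), hφ]
  simp only [htail]

theorem exists_realizes_localOp (hτ : bitTranspositions ⊆ Γ) (hlep : lepM21 ≤ Submonoid.closure Γ)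
    {κ : Type*} [Finite κ] (φ : (κ → Bool) → κ → Bool) :
    ∃ K, ∀ T (π : κ → ℕ), Function.Injective π → (∀ k, π k < T) →
      Realizes Γ T T K (localOp φ π) := by
  obtain ⟨d, ⟨e⟩⟩ := Finite.exists_equiv_fin κ
  have he : Function.Injective fun k => (e k : ℕ) := Fin.val_injective.comp e.injective
  obtain ⟨K, hK⟩ := exists_realizes_prefix hlep (d := d) (e := d)
    (φ := fun r => bits d (localOp φ (fun k => e k) fun t => r.getD t false)) (by simp)
  refine ⟨d + K + d, fun T π hπ hπT => ?_⟩
  have hπe : Function.Injective (π ∘ e.symm) := hπ.comp e.symm.injective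
  obtain ⟨t, rfl⟩ := Nat.exists_eq_add_of_le (le_of_injective_of_lt hπe fun j => hπT _)
  obtain ⟨σ, hσπ, -, hσ, hσ'⟩ := exists_perm_realizes hτ _ hπe fun j => hπT _
  have hprefix : Realizes Γ (d + t) (d + t) K (localOp φ fun k => e k) := by
    refine hK t _ (fun s => bits_congr fun t ht => ?_) fun s t => ?_
    · obtain ⟨k, hk⟩ := e.surjective ⟨t, ht⟩
      obtain rfl : (e k : ℕ) = t := congrArg Fin.val hk
      rw [localOp_apply he, localOp_apply he]
      congr 1
      funext k
      exact (getD_bits s (e k).2).symm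
    · exact localOp_apply_of_forall_ne s fun k => by have := (e k).2; omega
  have hconj : π = σ ∘ fun k => (e k : ℕ) := by
    funext k
    simp [hσπ]
  rw [hconj]
  exact ((hσ'.comp hprefix).comp hσ).congr fun s t _ =>
    (congrFun (localOp_perm_comp he σ s) t).symm

theorem exists_realizes_padLeft (hlep : lepM21 ≤ Submonoid.closure Γ) :
    ∃ K, ∀ T n, Realizes Γ T (n + T) (K * n) (padLeft n) := by
  obtain ⟨K, hK⟩ := exists_realizes_prefix hlep (d := 0) (e := 1) (φ := fun _ => [false]) (by simp)
  refine ⟨K, fun T n => ?_⟩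
  induction n with
  | zero => rw [Nat.zero_add]; exact (Realizes.id Γ T 0).congr fun s t _ => by simp [padLeft]
  | succ n ih =>
    have h := hK (n + T) (padLeft 1) (fun s => by simp [bits, padLeft]) fun s t => by simp [padLeft]
    rw [Nat.zero_add] at h
    convert h.comp ih using 1
    · omega
    · ring
    · funext s t
      rcases t with _ | t <;> simp [padLeft]

theorem exists_realizes_drop (hlep : lepM21 ≤ Submonoid.closure Γ) :
    ∃ K, ∀ T n, Realizes Γ (n + T) T (K * n) fun s t => s (n + t) := by
  obtain ⟨K, hK⟩ := exists_realizes_prefix hlep (d := 1) (e := 0) (φ := fun _ => []) (by simp)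
  refine ⟨K, fun T n => ?_⟩
  induction n with
  | zero => simpa using Realizes.id Γ T 0
  | succ n ih =>
    have h := hK (n + T) (fun s t => s (1 + t)) (fun s => by simp [bits]) fun s t => by simp
    rw [Nat.zero_add] at h
    convert ih.comp h using 1
    · omega
    · ring
    · funext s t
      exact congrArg s (by omega)

end Generators

/-- A configuration: a control bit `d`, then a register of `2 N + 1` bits of which only the one with
index `a` is set, then a tape with contents `G`. -/
def conf (N : ℕ) (d : Bool) (a : ℕ) (G : ℕ → Bool) : ℕ → Bool := fun t =>
  if t = 0 then d else if t < 2 * N + 2 then decide (t = a + 1) else G (t - (2 * N + 2))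

theorem conf_zero (N : ℕ) (d : Bool) (a : ℕ) (G : ℕ → Bool) : conf N d a G 0 = d := rfl

theorem conf_register {N t : ℕ} (d : Bool) (a : ℕ) (G : ℕ → Bool) (ht : t ≤ 2 * N) :
    conf N d a G (1 + t) = decide (t = a) := by
  rw [conf, if_neg (by omega), if_pos (by omega)]
  exact decide_eq_decide.2 (by omega)

theorem conf_tape (N : ℕ) (d : Bool) (a : ℕ) (G : ℕ → Bool) (p : ℕ) :
    conf N d a G (2 * N + 2 + p) = G p := by
  rw [conf, if_neg (by omega), if_neg (by omega), Nat.add_sub_cancel_left]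

theorem conf_position_cases (N t : ℕ) :
    t = 0 ∨ (∃ p ≤ 2 * N, t = 1 + p) ∨ ∃ p, t = 2 * N + 2 + p := by
  rcases t with _ | t
  · exact Or.inl rfl
  · rcases le_or_gt t (2 * N) with h | h
    · exact Or.inr (Or.inl ⟨t, h, add_comm t 1⟩)
    · exact Or.inr (Or.inr ⟨t - (2 * N + 1), by omega⟩)

theorem localOp_clear_conf (N : ℕ) (d : Bool) (a : ℕ) (G : ℕ → Bool) :
    localOp (fun _ _ => false) (fun _ : Unit => 0) (conf N d a G) = conf N false a G := by
  refine localOp_eq (Function.injective_of_subsingleton _) (fun _ => rfl) fun t ht => ?_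
  simp only [conf, if_neg (ht ()).symm]

section Controlled

variable {ι : Type*} {N c β a : ℕ} {d : Bool} {π : ι → ℕ} {G : ℕ → Bool}

/-- The positions, in a configuration, of the control bit, of the `2 c + 1` register bits with
indices `β, …, β + 2 c`, and of the tape cells `π`. -/
def window (N c β : ℕ) (π : ι → ℕ) : Option (Fin (2 * c + 1) ⊕ ι) → ℕ
  | none => 0
  | some (Sum.inl j) => 1 + (β + j)
  | some (Sum.inr k) => 2 * N + 2 + π k

/-- If the control bit is not set and the middle register bit of the window is, then set the
control bit, rewrite the tape cells by `ψ`, and move the set register bit to the index given by `ψ`.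
Otherwise do nothing. -/
def controlledOp (ψ : (ι → Bool) → Fin (2 * c + 1) × (ι → Bool))
    (w : Option (Fin (2 * c + 1) ⊕ ι) → Bool) : Option (Fin (2 * c + 1) ⊕ ι) → Bool :=
  if w none = false ∧ w (some (Sum.inl ⟨c, by omega⟩)) = true then fun
    | none => true
    | some (Sum.inl j) => decide (j = (ψ fun k => w (some (Sum.inr k))).1)
    | some (Sum.inr k) => (ψ fun k => w (some (Sum.inr k))).2 k
  else w

theorem window_injective (h : β + 2 * c ≤ 2 * N) (hπ : Function.Injective π) :
    Function.Injective (window N c β π) := by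
  rintro (_ | j | k) (_ | j' | k') heq <;> simp only [window] at heq <;> try omega
  · rfl
  · obtain rfl : j = j' := Fin.ext (by omega)
    rfl
  · obtain rfl : k = k' := hπ (by omega)
    rfl

theorem controlledOp_condition_iff (h : β + 2 * c ≤ 2 * N) :
    (conf N d a G ∘ window N c β π) none = false ∧
      (conf N d a G ∘ window N c β π) (some (Sum.inl ⟨c, by omega⟩)) = true ↔
    d = false ∧ β + c = a := by
  simp only [Function.comp_apply, window, conf_zero]
  rw [conf_register _ _ _ (by omega), decide_eq_true_iff]

theorem localOp_controlledOp_eq_self {ψ : (ι → Bool) → Fin (2 * c + 1) × (ι → Bool)}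
    (h : β + 2 * c ≤ 2 * N) (hπ : Function.Injective π) (hda : ¬(d = false ∧ β + c = a)) :
    localOp (controlledOp ψ) (window N c β π) (conf N d a G) = conf N d a G :=
  localOp_eq_self (window_injective h hπ) (if_neg (mt (controlledOp_condition_iff h).1 hda))

theorem localOp_controlledOp {ψ : (ι → Bool) → Fin (2 * c + 1) × (ι → Bool)}
    (h : β + 2 * c ≤ 2 * N) (hπ : Function.Injective π) :
    localOp (controlledOp ψ) (window N c β π) (conf N false (β + c) G) =
      conf N true (β + (ψ (G ∘ π)).1) (localOp (fun w => (ψ w).2) π G) := by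
  have htape : (fun k => (conf N false (β + c) G ∘ window N c β π) (some (Sum.inr k))) = G ∘ π :=
    funext fun k => conf_tape _ _ _ _ _
  refine localOp_eq (window_injective h hπ) (fun k => ?_) fun t ht => ?_
  · rw [controlledOp, if_pos ((controlledOp_condition_iff h).2 ⟨rfl, rfl⟩)]
    simp only [htape]
    rcases k with _ | j | k
    · rfl
    · simp only [window]
      rw [conf_register _ _ _ (by omega)]
      exact decide_eq_decide.2 (by rw [Fin.ext_iff]; omega)
    · simp only [window, conf_tape, localOp_apply hπ]
  · rcases conf_position_cases N t with rfl | ⟨p, hp, rfl⟩ | ⟨p, rfl⟩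
    · exact absurd rfl (ht none)
    · have hpj (j : Fin (2 * c + 1)) : p ≠ β + j := fun hj =>
        ht (some (Sum.inl j)) (by rw [hj]; rfl)
      have hpc : p ≠ β + c := hpj ⟨c, by omega⟩
      rw [conf_register _ _ _ hp, conf_register _ _ _ hp]
      exact decide_eq_decide.2 (iff_of_false hpc (hpj _))
    · rw [conf_tape, conf_tape, localOp_apply_of_forall_ne]
      rintro k rfl
      exact ht (some (Sum.inr k)) rfl

theorem exists_realizes_controlled {Γ : Set M21} (hτ : bitTranspositions ⊆ Γ)
    (hlep : lepM21 ≤ Submonoid.closure Γ) [Finite ι]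
    (ψ : (ι → Bool) → Fin (2 * c + 1) × (ι → Bool)) :
    ∃ K, ∀ e L (π : ℕ → ι → ℕ), (∀ β, Function.Injective (π β)) → (∀ β ≤ 2 * e, ∀ k, π β k < L) →
      ∃ op, Realizes Γ (2 * (e + c) + 2 + L) (2 * (e + c) + 2 + L) (K * (e + c + 1)) op ∧
        ∀ β ≤ 2 * e, ∀ G, op (conf (e + c) false (β + c) G) =
          conf (e + c) false (β + (ψ (G ∘ π β)).1) (localOp (fun w => (ψ w).2) (π β) G) := by
  obtain ⟨K, hK⟩ := exists_realizes_localOp hτ hlep (controlledOp ψ)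
  obtain ⟨K₀, hK₀⟩ := exists_realizes_localOp hτ hlep (κ := Unit) fun _ _ => false
  refine ⟨K * 2 + K₀, fun e L π hπ hπL => ?_⟩
  have hstep (β : ℕ) (hβ : β < 2 * e + 1) :
      Realizes Γ (2 * (e + c) + 2 + L) (2 * (e + c) + 2 + L) K
        (localOp (controlledOp ψ) (window (e + c) c β (π β))) := by
    refine hK _ _ (window_injective (by omega) (hπ β)) ?_
    rintro (_ | j | k)
    · exact Nat.lt_of_lt_of_le Nat.two_pos (by omega)
    · simp only [window]
      omega
    · have := hπL β (by omega) k
      simp only [window]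
      omega
  obtain ⟨sweep, hsweep, hsweep'⟩ := Realizes.exists_sweep (2 * e + 1) hstep
  have hclear := hK₀ (2 * (e + c) + 2 + L) (fun _ => 0) (Function.injective_of_subsingleton _)
    fun _ => by omega
  refine ⟨_, (hclear.comp hsweep).mono (by nlinarith), fun β hβ G => ?_⟩
  rw [hsweep' _ _ β (fun β' hβ' hne => localOp_controlledOp_eq_self (by omega) (hπ β') (by omega))
    (fun β' hβ' => localOp_controlledOp_eq_self (by omega) (hπ β') (by simp))
    (localOp_controlledOp (by omega) (hπ β)), if_pos (by omega), localOp_clear_conf]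

end Controlled

/-- The word on the tape `G` between the positions `a` and `L`. -/
def tapeWord (L : ℕ) (G : ℕ → Bool) (a : ℕ) : Word := bits (L - a) fun i => G (a + i)

theorem tapeWord_eq_append {L a k : ℕ} (h : a + k ≤ L) (G : ℕ → Bool) :
    tapeWord L G a = bits k (fun i => G (a + i)) ++ tapeWord L G (a + k) := by
  rw [tapeWord, show L - a = k + (L - (a + k)) by omega, bits_add]
  simp only [tapeWord, add_assoc]

theorem tapeWord_congr {L a : ℕ} {G G' : ℕ → Bool} (h : ∀ p, a ≤ p → G p = G' p) :
    tapeWord L G a = tapeWord L G' a :=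
  bits_congr fun i _ => h _ (Nat.le_add_right a i)

/-- Whenever `f` is defined on the tape word of a configuration whose index differs from `N` by at
most `e`, the operation `op` produces a configuration for the image of that word. It changes the
index by at most `c`, and the tape only at positions in `S`. -/
def Simulates (N L e c : ℕ) (S : Finset ℕ) (op : (ℕ → Bool) → ℕ → Bool) (f : RIHom) : Prop :=
  ∀ a G v, N ≤ a + e → a ≤ N + e → f.toFun (tapeWord L G a) = some v →
    ∃ a' G', op (conf N false a G) = conf N false a' G' ∧ a' ≤ a + c ∧ a ≤ a' + c ∧
      v = tapeWord L G' a' ∧ ∀ p ∉ S, G' p = G p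

theorem Simulates.comp {N L e c c' : ℕ} {S S' : Finset ℕ} {op op' : (ℕ → Bool) → ℕ → Bool}
    {f g : RIHom} (hf : Simulates N L (e + c) c' S' op' f) (hg : Simulates N L e c S op g) :
    Simulates N L e (c + c') (S ∪ S') (fun s => op' (op s)) (f.comp g) := by
  intro a G v ha ha' hv
  obtain ⟨u, hu, hv⟩ := comp_eq_some.1 hv
  obtain ⟨a₁, G₁, hop₁, ha₁, ha₁', rfl, hS₁⟩ := hg a G u ha ha' hu
  obtain ⟨a₂, G₂, hop₂, ha₂, ha₂', rfl, hS₂⟩ := hf a₁ G₁ v (by omega) (by omega) hv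
  refine ⟨a₂, G₂, (congrArg op' hop₁).trans hop₂, by omega, by omega, rfl, fun p hp => ?_⟩
  rw [Finset.notMem_union] at hp
  rw [hS₂ p hp.2, hS₁ p hp.1]

/-- For all long tapes, some operation of word-length at most `k` over `Γ` simulates `f`, changing
the tape at no more than `k` positions. -/
def Simulable (Γ : Set M21) (N e c k : ℕ) (f : RIHom) : Prop :=
  ∀ᶠ L in atTop, ∃ op, Realizes Γ (2 * N + 2 + L) (2 * N + 2 + L) k op ∧
    ∃ S : Finset ℕ, S.card ≤ k ∧ Simulates N L e c S op f

namespace Simulable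

variable {Γ : Set M21} {N e e' c c' k k' : ℕ} {f g : RIHom}

theorem mono (h : Simulable Γ N e c k f) (he : e' ≤ e) (hc : c ≤ c') (hk : k ≤ k') :
    Simulable Γ N e' c' k' f := by
  filter_upwards [h] with L ⟨op, hop, S, hS, hsim⟩
  refine ⟨op, hop.mono hk, S, hS.trans hk, fun a G v ha ha' hv => ?_⟩
  obtain ⟨a₁, G₁, hop₁, ha₁, ha₁', h₁⟩ := hsim a G v (by omega) (by omega) hv
  exact ⟨a₁, G₁, hop₁, by omega, by omega, h₁⟩

theorem id (Γ : Set M21) (N e : ℕ) : Simulable Γ N e 0 0 RIHom.id :=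
  Eventually.of_forall fun _ => ⟨_, Realizes.id _ _ _, ∅, by simp, fun a G _ _ _ hv =>
    ⟨a, G, rfl, le_rfl, le_rfl, (Option.some.inj hv).symm, fun _ _ => rfl⟩⟩

theorem comp (hf : Simulable Γ N (e + c) c' k' f) (hg : Simulable Γ N e c k g) :
    Simulable Γ N e (c + c') (k + k') (f.comp g) := by
  filter_upwards [hf, hg] with L ⟨op', hop', S', hS', hsim'⟩ ⟨op, hop, S, hS, hsim⟩
  exact ⟨_, (hop'.comp hop).mono (add_comm k' k).le, S ∪ S',
    (Finset.card_union_le S S').trans (add_le_add hS hS'), hsim'.comp hsim⟩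

theorem exists_list_prod {n : ℕ} (l : List M21) (hl : ∀ γ ∈ l, Simulable Γ N (c * n) c k γ.1)
    (hn : l.length ≤ n) :
    ∃ f, M21.mk f = l.prod ∧ Simulable Γ N 0 (c * l.length) (k * l.length) f := by
  induction l with
  | nil => exact ⟨RIHom.id, rfl, id Γ N 0⟩
  | cons γ l ih =>
    obtain ⟨hγ, hl⟩ := List.forall_mem_cons.1 hl
    rw [List.length_cons] at hn ⊢
    obtain ⟨f, hf, hsim⟩ := ih hl (Nat.le_of_succ_le hn)
    refine ⟨γ.1.comp f, by rw [← M21.mk_mul_mk, M21.mk_val, hf, List.prod_cons], ?_⟩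
    have hle : 0 + c * l.length ≤ c * n := by
      rw [Nat.zero_add]
      exact Nat.mul_le_mul_left c (Nat.le_of_succ_le hn)
    exact (hγ.mono hle le_rfl le_rfl).comp hsim

end Simulable

section Generators

variable {Γ : Set M21}

theorem exists_simulable_of_local (hτ : bitTranspositions ⊆ Γ)
    (hlep : lepM21 ≤ Submonoid.closure Γ) {ι : Type*} [Finite ι] {c : ℕ}
    (ψ : (ι → Bool) → Fin (2 * c + 1) × (ι → Bool)) :
    ∃ K, ∀ e (π : ℕ → ι → ℕ) (f : RIHom), (∀ β, Function.Injective (π β)) →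
      (∀ᶠ L in atTop, ∀ β ≤ 2 * e, ∀ G v, f.toFun (tapeWord L G (β + c)) = some v →
        v = tapeWord L (localOp (fun w => (ψ w).2) (π β) G) (β + (ψ (G ∘ π β)).1)) →
      Simulable Γ (e + c) e c (K * (e + c + 1)) f := by
  cases nonempty_fintype ι
  obtain ⟨K, hK⟩ := exists_realizes_controlled hτ hlep ψ
  refine ⟨K + 2 * Fintype.card ι, fun e π f hπ hf => ?_⟩
  let S := (Finset.range (2 * e + 1)).biUnion fun β => Finset.univ.image (π β)
  have mem_S {β : ℕ} (hβ : β ≤ 2 * e) (k : ι) : π β k ∈ S :=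
    Finset.mem_biUnion.2 ⟨β, by simpa [Nat.lt_succ_iff] using hβ,
      Finset.mem_image_of_mem _ (Finset.mem_univ k)⟩
  have card_S : S.card ≤ (2 * e + 1) * Fintype.card ι := by
    rw [← Finset.card_range (2 * e + 1)]
    exact Finset.card_biUnion_le_card_mul _ _ _ fun β _ => Finset.card_image_le
  filter_upwards [hf, eventually_gt_atTop (S.sup id)] with L hfL hSL
  obtain ⟨op, hop, hop'⟩ := hK e L π hπ fun β hβ k =>
    (Finset.le_sup (f := id) (mem_S hβ k)).trans_lt hSL
  refine ⟨op, hop.mono (by nlinarith), S, card_S.trans (by nlinarith), fun a G v ha ha' hv => ?_⟩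
  obtain ⟨β, rfl⟩ : ∃ β, a = β + c := ⟨a - c, by omega⟩
  have hβ : β ≤ 2 * e := by omega
  refine ⟨_, _, hop' β hβ G, by omega, by omega, hfL β hβ G v hv, fun p hp => ?_⟩
  refine localOp_apply_of_forall_ne G ?_
  rintro k rfl
  exact hp (mem_S hβ k)

theorem exists_simulable_swap (hτ : bitTranspositions ⊆ Γ)
    (hlep : lepM21 ≤ Submonoid.closure Γ) :
    ∃ K, ∀ e, ∀ γ ∈ bitTranspositions, Simulable Γ e e 0 (K * (e + 1)) γ.1 := by
  obtain ⟨K, hK⟩ := exists_simulable_of_local hτ hlep (c := 0) fun w : Bool → Bool =>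
    (0, fun b => w !b)
  refine ⟨K, ?_⟩
  rintro e _ ⟨i, j, hij, rfl⟩
  have hinj (β : ℕ) : Function.Injective fun b : Bool => β + bif b then j else i := by
    rintro (_ | _) (_ | _) h <;> simp at h ⊢ <;> omega
  refine hK e _ _ hinj ?_
  filter_upwards [eventually_gt_atTop (2 * e + j)] with L hL β hβ G v hv
  rw [tapeWord, M21.mk_apply (swapHom_bits (by omega) (by omega) _), Option.some_inj] at hv
  rw [← hv]
  refine bits_congr fun t _ => ?_
  rw [add_zero, Fin.val_zero, add_zero]
  rcases eq_or_ne t i with rfl | hti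
  · rw [Equiv.swap_apply_left]
    exact (localOp_apply (φ := fun w b => w !b) (hinj β) G false).symm
  rcases eq_or_ne t j with rfl | htj
  · rw [Equiv.swap_apply_right]
    exact (localOp_apply (φ := fun w b => w !b) (hinj β) G true).symm
  rw [Equiv.swap_apply_of_ne_of_ne hti htj, localOp_apply_of_forall_ne]
  rintro (_ | _) <;> simp only [cond_true, cond_false] <;> omega

theorem RIHom.eventually_apply_append (f : RIHom) : ∀ᶠ c in atTop, ∀ r z v : Word,
    r.length = c → f.toFun (r ++ z) = some v →
      ∃ q, f.toFun r = some q ∧ v = q ++ z ∧ q.length ≤ 2 * c := by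
  obtain ⟨L, hL⟩ := f.fg.bounded
  obtain ⟨B, hB⟩ := ((List.finite_length_le Bool L).image
    fun p => ((f.toFun p).getD []).length).bddAbove
  filter_upwards [eventually_ge_atTop (L + B)] with c hc r z v hr hv
  obtain ⟨p, ⟨y, hy⟩, hpl, w, hw⟩ := hL _ ⟨v, hv⟩
  have hyB : y.length ≤ B := hB ⟨p, hpl, by simp [hy]⟩
  obtain ⟨t, rfl⟩ : ∃ t, r = p ++ t := by
    rcases append_cases hw with ⟨t, rfl⟩ | h
    · rw [List.length_append] at hpl
      obtain rfl : t = [] := List.length_eq_zero_iff.1 (by omega)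
      exact ⟨[], by simp⟩
    · exact h
  refine ⟨y ++ t, f.map_append _ _ _ hy, ?_, ?_⟩
  · rw [List.append_assoc, f.map_append _ _ _ hy, Option.some_inj] at hv
    rw [List.append_assoc, hv]
  · rw [List.length_append] at hr ⊢
    omega

/-- The local rule that simulates `f` on a tape word starting in the middle of a block of `2 c`
cells: it writes the image under `f` of the prefix of length `c` at the end of the block, and
returns its starting point. What it writes before that point is irrelevant. -/
def prefixRule (f : RIHom) (c : ℕ) (w : Fin (2 * c) → Bool) :
    Fin (2 * c + 1) × (Fin (2 * c) → Bool) :=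
  let q := (f.toFun (bits c fun t => if h : c + t < 2 * c then w ⟨c + t, h⟩ else false)).getD []
  (⟨2 * c - q.length, by omega⟩, fun j => q.getD (j - (2 * c - q.length)) false)

theorem prefixRule_eq {f : RIHom} {c a : ℕ} {G : ℕ → Bool} {q : Word}
    (h : f.toFun (bits c fun t => G (a + c + t)) = some q) :
    ((prefixRule f c fun j => G (a + j)).1 : ℕ) = 2 * c - q.length ∧
      ∀ j, (prefixRule f c fun j => G (a + j)).2 j = q.getD (j - (2 * c - q.length)) false := by
  have hblock : (bits c fun t => if c + t < 2 * c then G (a + (c + t)) else false) =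
      bits c fun t => G (a + c + t) :=
    bits_congr fun t ht => by rw [if_pos (by omega), add_assoc]
  simp only [prefixRule, dite_eq_ite, hblock, h, Option.getD_some, implies_true, and_self]

theorem exists_simulable (hτ : bitTranspositions ⊆ Γ) (hlep : lepM21 ≤ Submonoid.closure Γ)
    (f : RIHom) :
    ∀ᶠ c in atTop, ∃ K, ∀ e, Simulable Γ (e + c) e c (K * (e + c + 1)) f := by
  filter_upwards [f.eventually_apply_append] with c hc
  obtain ⟨K, hK⟩ := exists_simulable_of_local hτ hlep (prefixRule f c)
  refine ⟨K, fun e => ?_⟩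
  have hinj (β : ℕ) : Function.Injective fun j : Fin (2 * c) => β + j :=
    (add_right_injective β).comp Fin.val_injective
  refine hK e (fun β j => β + j) f hinj ?_
  filter_upwards [eventually_ge_atTop (2 * e + 2 * c)] with L hL β hβ G v hv
  rw [tapeWord_eq_append (k := c) (by omega)] at hv
  obtain ⟨q, hq, rfl, hqc⟩ := hc _ _ _ (length_bits _ _) hv
  obtain ⟨hstart, hwrite⟩ := prefixRule_eq hq
  have hβc : β + (2 * c - q.length) + q.length = β + c + c := by omega
  rw [Function.comp_def, hstart,
    tapeWord_eq_append (a := β + (2 * c - q.length)) (k := q.length) (by omega), hβc]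
  congr 1
  · refine (bits_getD q).symm.trans (bits_congr fun t ht => ?_)
    have hj : 2 * c - q.length + t < 2 * c := by omega
    rw [add_assoc]
    refine .trans ?_ (localOp_apply (hinj β) G ⟨_, hj⟩).symm
    rw [Function.comp_def, hwrite, Nat.add_sub_cancel_left]
  · refine tapeWord_congr fun p hp => (localOp_apply_of_forall_ne G fun j => ?_).symm
    omega

theorem exists_uniform_simulable (hτ : bitTranspositions ⊆ Γ)
    (hlep : lepM21 ≤ Submonoid.closure Γ) {Δ : Set M21} (hΔ : Δ.Finite) :
    ∃ c K, ∀ e, ∀ γ ∈ Δ ∪ bitTranspositions, Simulable Γ (e + c) e c (K * (e + c + 1)) γ.1 := by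
  obtain ⟨c, hc⟩ := ((Filter.eventually_all_finite hΔ).2 fun γ _ =>
    exists_simulable hτ hlep γ.1).exists
  choose! K hK using hc
  obtain ⟨B, hB⟩ := (hΔ.image K).bddAbove
  obtain ⟨K', hK'⟩ := exists_simulable_swap hτ hlep
  refine ⟨c, B + K', fun e γ hγ => ?_⟩
  rcases hγ with hγ | hγ
  · refine (hK γ hγ e).mono le_rfl le_rfl (Nat.mul_le_mul_right _ ?_)
    exact (hB ⟨γ, hγ, rfl⟩).trans (Nat.le_add_right B K')
  · refine (hK' (e + c) γ hγ).mono (Nat.le_add_right e c) (Nat.zero_le c) ?_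
    exact Nat.mul_le_mul_right _ (Nat.le_add_left K' B)

theorem exists_simulable_of_mem_closure (hτ : bitTranspositions ⊆ Γ)
    (hlep : lepM21 ≤ Submonoid.closure Γ) {Δ : Set M21} (hΔ : Δ.Finite) :
    ∃ c K, ∀ a ∈ Submonoid.closure (Δ ∪ bitTranspositions), ∀ n,
      wordLength (Δ ∪ bitTranspositions) a ≤ n →
        ∃ f, M21.mk f = a ∧ Simulable Γ (c * n + c) 0 (c * n) (K * (c * n + c + 1) * n) f := by
  obtain ⟨c, K, h⟩ := exists_uniform_simulable hτ hlep hΔ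
  refine ⟨c, K, fun a ha n han => ?_⟩
  obtain ⟨l, hl, rfl, hla⟩ := exists_list_length_eq_wordLength ha
  rw [← hla] at han
  obtain ⟨f, hf, hsim⟩ := Simulable.exists_list_prod l (fun γ hγ => h (c * n) γ (hl γ hγ)) han
  exact ⟨f, hf, hsim.mono le_rfl (Nat.mul_le_mul_left _ han) (Nat.mul_le_mul_left _ han)⟩

theorem exists_realizes_start (hτ : bitTranspositions ⊆ Γ) (hlep : lepM21 ≤ Submonoid.closure Γ) :
    ∃ K, ∀ N m, Realizes Γ m (2 * N + 2 + (N + m)) (K * (N + 1)) fun s =>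
      conf N false N (padLeft N s) := by
  obtain ⟨K, hK⟩ := exists_realizes_padLeft hlep
  obtain ⟨K', hK'⟩ := exists_realizes_localOp hτ hlep (κ := Unit) fun _ _ => true
  refine ⟨3 * K + K', fun N m => ?_⟩
  have hinj : Function.Injective fun _ : Unit => 1 + N := Function.injective_of_subsingleton _
  have hpad := hK m (3 * N + 2)
  rw [show 3 * N + 2 + m = 2 * N + 2 + (N + m) by omega] at hpad
  refine (((hK' _ _ hinj fun _ => by omega).comp hpad).mono (by nlinarith)).congr fun s t _ => ?_
  refine congrFun (localOp_eq hinj (fun _ => ?_) fun t ht => ?_) t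
  · rw [conf_register _ _ _ (by omega), decide_eq_true rfl]
  rcases conf_position_cases N t with rfl | ⟨p, hp, rfl⟩ | ⟨p, rfl⟩
  · exact if_pos (by omega)
  · rw [conf_register _ _ _ hp, padLeft, if_pos (by omega), decide_eq_false]
    exact fun h => ht () (by rw [h])
  · rw [conf_tape, padLeft, padLeft]
    congr 1
    · rw [eq_iff_iff]
      omega
    · congr 1
      omega

theorem exists_realizes_tape (hlep : lepM21 ≤ Submonoid.closure Γ) :
    ∃ K, ∀ N m, Realizes Γ (2 * N + 2 + (N + m)) m (K * (N + 1)) fun s t =>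
      s (2 * N + 2 + (N + t)) := by
  obtain ⟨K, hK⟩ := exists_realizes_drop hlep
  refine ⟨3 * K, fun N m => ?_⟩
  have hdrop := hK m (3 * N + 2)
  rw [show 3 * N + 2 + m = 2 * N + 2 + (N + m) by omega] at hdrop
  exact (hdrop.mono (by nlinarith)).congr fun s t _ => congrArg s (by omega)

end Generators

theorem eventually_toFun_bits {f : RIHom} (hf : Essential (M21.mk f).1.dom)
    (hlen : LengthPreserving (M21.mk f).1) :
    ∀ᶠ m in atTop, ∀ s, ∃ s', f.toFun (bits m s) = some (bits m s') := by
  have hdom : Essential f.dom := essential_iff.2 fun x => by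
    obtain ⟨z, y, hy⟩ := essential_iff.1 hf x
    obtain ⟨w, hw⟩ := (essRestr_iff.1 (essRestr_max f)).2 _ _ hy
    exact ⟨z ++ w, y ++ w, by rwa [← List.append_assoc]⟩
  filter_upwards [hdom.eventually_mem f.dom_isRightIdeal f.fg] with m hm s
  obtain ⟨y, hy⟩ := hm _ (length_bits m s)
  have hym : y.length = m := (hlen _ _ (M21.mk_apply hy)).symm.trans (length_bits m s)
  refine ⟨fun t => y.getD t false, ?_⟩
  rw [← hym, bits_getD, hym, hy]

theorem Simulates.exists_conf {N m e c : ℕ} {S : Finset ℕ} {op : (ℕ → Bool) → ℕ → Bool} {f : RIHom}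
    (h : Simulates N (N + m) e c S op f) (hm : 0 < m) {s s' : ℕ → Bool}
    (hs : f.toFun (bits m s) = some (bits m s')) :
    ∃ G, op (conf N false N (padLeft N s)) = conf N false N G ∧
      (bits m fun t => G (N + t)) = bits m s' ∧ ∀ t, N + t ∉ S → G (N + t) = s t := by
  have hpad (t : ℕ) : padLeft N s (N + t) = s t := by simp [padLeft]
  have htape : tapeWord (N + m) (padLeft N s) N = bits m s := by
    rw [tapeWord, Nat.add_sub_cancel_left]
    exact bits_congr fun t _ => hpad t
  obtain ⟨a, G, hop, -, -, hG, hS⟩ := h N (padLeft N s) _ (by omega) (by omega) (htape ▸ hs)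
  obtain rfl : a = N := by
    have := congrArg List.length hG
    rw [tapeWord, length_bits, length_bits] at this
    omega
  rw [tapeWord, Nat.add_sub_cancel_left] at hG
  exact ⟨G, hop, hG.symm, fun t ht => (hS _ ht).trans (hpad t)⟩

/-- On words of length `m`, the element `a` preserves the length and changes only letters at
positions in `S`. -/
def SupportedOn (a : M21) (m : ℕ) (S : Finset ℕ) : Prop :=
  ∀ s, ∃ s', a.1.toFun (bits m s) = some (bits m s') ∧ ∀ t ∉ S, s' t = s t

namespace Simulable

variable {Γ : Set M21} {f : RIHom}

theorem exists_simulates {N e c k : ℕ} (h : Simulable Γ N e c k f)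
    (hf : Essential (M21.mk f).1.dom) (hlen : LengthPreserving (M21.mk f).1) :
    ∃ m > 0, (∀ s, ∃ s', f.toFun (bits m s) = some (bits m s')) ∧
      ∃ op, Realizes Γ (2 * N + 2 + (N + m)) (2 * N + 2 + (N + m)) k op ∧
        ∃ S : Finset ℕ, S.card ≤ k ∧ Simulates N (N + m) e c S op f := by
  have h' := (tendsto_add_atTop_iff_nat (f := fun m => m) N).2 tendsto_id |>.eventually h
  simp only [add_comm _ N] at h'
  exact ((eventually_gt_atTop 0).and ((eventually_toFun_bits hf hlen).and h')).exists

theorem exists_wordLength_le (hτ : bitTranspositions ⊆ Γ) (hlep : lepM21 ≤ Submonoid.closure Γ) :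
    ∃ K, ∀ N e c k (f : RIHom), Simulable Γ N e c k f → Essential (M21.mk f).1.dom →
      LengthPreserving (M21.mk f).1 → wordLength Γ (M21.mk f) ≤ k + K * (N + 1) := by
  obtain ⟨K, hK⟩ := exists_realizes_start hτ hlep
  obtain ⟨K', hK'⟩ := exists_realizes_tape hlep
  refine ⟨K + K', fun N e c k f h hf hlen => ?_⟩
  obtain ⟨m, hm, hfm, op, hop, S, -, hsim⟩ := h.exists_simulates hf hlen
  obtain ⟨a, -, ha, hab⟩ := ((hK' N m).comp hop).comp (hK N m)
  have heq : M21.mk f = a := M21.ext_bits m fun s => by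
    obtain ⟨s', hs'⟩ := hfm s
    obtain ⟨G, hG, hGs', -⟩ := hsim.exists_conf hm hs'
    refine ⟨_, M21.mk_apply hs', ?_⟩
    rw [hab, ← hGs']
    simp only [hG, conf_tape]
  rw [heq]
  exact ha.trans (by linarith)

theorem exists_supportedOn {N e c k : ℕ} (h : Simulable Γ N e c k f)
    (hf : Essential (M21.mk f).1.dom) (hlen : LengthPreserving (M21.mk f).1) :
    ∃ m S, S.card ≤ k ∧ SupportedOn (M21.mk f) m S := by
  obtain ⟨m, hm, hfm, op, -, S, hS, hsim⟩ := h.exists_simulates hf hlen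
  refine ⟨m, S.image (· - N), Finset.card_image_le.trans hS, fun s => ?_⟩
  obtain ⟨s', hs'⟩ := hfm s
  obtain ⟨G, -, hGs', hGS⟩ := hsim.exists_conf hm hs'
  refine ⟨fun t => G (N + t), by rw [M21.mk_apply hs', hGs'], fun t ht => hGS t fun h => ht ?_⟩
  exact Finset.mem_image.2 ⟨_, h, Nat.add_sub_cancel_left N t⟩

end Simulable

theorem exists_wordLength_le_mul_sq {Γ Δ : Set M21} (hτ : bitTranspositions ⊆ Γ)
    (hlep : lepM21 ≤ Submonoid.closure Γ) (hΔ : Δ.Finite) :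
    ∃ C > 0, ∀ a ∈ Submonoid.closure (Δ ∪ bitTranspositions), Essential a.1.dom →
      LengthPreserving a.1 → wordLength Γ a ≤ C * wordLength (Δ ∪ bitTranspositions) a ^ 2 := by
  obtain ⟨c, K, hsim⟩ := exists_simulable_of_mem_closure hτ hlep hΔ
  obtain ⟨K', hK'⟩ := Simulable.exists_wordLength_le hτ hlep
  refine ⟨(K + K') * (2 * c + 1) + 1, Nat.succ_pos _, fun a ha hdom hlen => ?_⟩
  rcases Nat.eq_zero_or_pos (wordLength (Δ ∪ bitTranspositions) a) with h | h
  · rw [eq_one_of_wordLength_eq_zero ha h, wordLength_one]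
    exact Nat.zero_le _
  set n := wordLength (Δ ∪ bitTranspositions) a with hn
  obtain ⟨f, rfl, hf⟩ := hsim a ha n le_rfl
  have hlinear : c * n + c + 1 ≤ (2 * c + 1) * n := by nlinarith
  calc wordLength Γ (M21.mk f) ≤ K * (c * n + c + 1) * n + K' * (c * n + c + 1) :=
        hK' _ _ _ _ f hf hdom hlen
    _ ≤ K * (c * n + c + 1) * n + K' * (c * n + c + 1) * n :=
        Nat.add_le_add_left (Nat.le_mul_of_pos_right _ h) _
    _ = (K + K') * (c * n + c + 1) * n := by ring
    _ ≤ (K + K') * ((2 * c + 1) * n) * n := by gcongr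
    _ ≤ ((K + K') * (2 * c + 1) + 1) * n ^ 2 := by nlinarith

theorem exists_supportedOn_of_wordLength_le {Δ : Set M21} (hΔ : Δ.Finite) (n : ℕ) :
    ∃ B, ∀ a ∈ Submonoid.closure (Δ ∪ bitTranspositions),
      wordLength (Δ ∪ bitTranspositions) a ≤ n → Essential a.1.dom → LengthPreserving a.1 →
        ∃ m S, S.card ≤ B ∧ SupportedOn a m S := by
  obtain ⟨c, K, hsim⟩ := exists_simulable_of_mem_closure (Γ := lepM21 ∪ bitTranspositions)
    Set.subset_union_right (fun a ha => Submonoid.subset_closure (Or.inl ha)) hΔ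
  refine ⟨K * (c * n + c + 1) * n, fun a ha han hdom hlen => ?_⟩
  obtain ⟨f, rfl, hf⟩ := hsim a ha n han
  exact hf.exists_supportedOn hdom hlen

theorem M21.pow_apply_iterate {a : M21} {X : Set Word} {F : X → X}
    (hF : ∀ x : X, a.1.toFun x = some (F x : Word)) (k : ℕ) (x : X) :
    (a ^ k).1.toFun x = some (F^[k] x : Word) := by
  induction k generalizing x with
  | zero => exact M21.one_apply _
  | succ k ih =>
    rw [pow_succ]
    exact M21.mul_apply (hF x) (ih _)

/-- The words of length `m` that agree with `s` outside `S`. -/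
def cylinder (m : ℕ) (S : Finset ℕ) (s : ℕ → Bool) : Set Word :=
  {x | ∃ s', bits m s' = x ∧ ∀ t ∉ S, s' t = s t}

theorem exists_surjective_cylinder (m : ℕ) (S : Finset ℕ) (s : ℕ → Bool) :
    ∃ p : (S → Bool) → cylinder m S s, Function.Surjective p := by
  refine ⟨fun w => ⟨_, fun t => if h : t ∈ S then w ⟨t, h⟩ else s t, rfl, fun t ht => dif_neg ht⟩,
    ?_⟩
  rintro ⟨_, s', rfl, hs'⟩
  refine ⟨fun t => s' t, Subtype.ext (bits_congr fun t _ => ?_)⟩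
  by_cases ht : t ∈ S
  · exact dif_pos ht
  · exact (dif_neg ht).trans (hs' t ht).symm

theorem SupportedOn.pow_factorial_eq_one {a : M21} {m K : ℕ} {S : Finset ℕ}
    (h : SupportedOn a m S)
    (hinj : ∀ x₁ x₂ y : Word, a.1.toFun x₁ = some y → a.1.toFun x₂ = some y → x₁ = x₂)
    (hK : 2 ^ S.card ≤ K) : a ^ K.factorial = 1 := by
  refine M21.ext_bits m fun s => ⟨bits m s, ?_, M21.one_apply _⟩
  have hmaps (x : cylinder m S s) : ∃ y : cylinder m S s, a.1.toFun x = some (y : Word) := by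
    obtain ⟨_, s', rfl, hs'⟩ := x
    obtain ⟨s'', hs'', hS⟩ := h s'
    exact ⟨⟨_, s'', rfl, fun t ht => (hS t ht).trans (hs' t ht)⟩, hs''⟩
  choose F hF using hmaps
  have hFinj : Function.Injective F := fun x x' hx =>
    Subtype.ext (hinj _ _ _ (hF x) (hx ▸ hF x'))
  obtain ⟨p, hp⟩ := exists_surjective_cylinder m S s
  have := Finite.of_surjective p hp
  have := Fintype.ofFinite (cylinder m S s)
  have hcard : Fintype.card (cylinder m S s) ≤ K := by
    refine (Fintype.card_le_of_surjective p hp).trans ?_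
    simpa using hK
  have hperiod : F^[K.factorial] = _root_.id := by
    obtain ⟨j, hj⟩ := Nat.factorial_dvd_factorial hcard
    rw [hj, Function.iterate_mul,
      Function.injective_iff_iterate_factorial_card_eq_id.1 hFinj, Function.iterate_id]
  have hs : bits m s ∈ cylinder m S s := ⟨s, rfl, fun _ _ => rfl⟩
  have happly := M21.pow_apply_iterate hF K.factorial ⟨_, hs⟩
  rwa [hperiod] at happly

theorem bddAbove_asymmetrySet {G : Subgroup M21ˣ} (hG : G ≤ lpG21) {Δ : Set M21} (hΔ : Δ.Finite)
    (hGΔ : ∀ g ∈ G, (g : M21) ∈ Submonoid.closure (Δ ∪ bitTranspositions)) (n : ℕ) :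
    BddAbove (asymmetrySet G (Δ ∪ bitTranspositions) n) := by
  obtain ⟨B, hB⟩ := exists_supportedOn_of_wordLength_le hΔ n
  refine bddAbove_asymmetrySet_of_pow_eq_one (2 ^ B).factorial_pos hGΔ fun g hg hgn => ?_
  obtain ⟨hiso, hlen⟩ := hG hg
  obtain ⟨m, S, hS, hsupp⟩ := hB g (hGΔ g hg) hgn hiso.1 hlen
  exact Units.ext (hsupp.pow_factorial_eq_one hiso.2.2 (Nat.pow_le_pow_right two_pos hS))

end Thompson

theorem mainTheorem7_general {G : Subgroup Thompson.M21ˣ} (hG : G ≤ Thompson.lpG21)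
    {Γ Δ : Set Thompson.M21} (hΓ_fin : Γ.Finite) (hΔ_fin : Δ.Finite)
    (hΓ : Thompson.lepM21 ≤ Submonoid.closure (Γ ∪ Thompson.bitTranspositions))
    (hΔ : Γ ⊆ Submonoid.closure (Δ ∪ Thompson.bitTranspositions)) :
    (∀ n : ℕ, IsGreatest (asymmetrySet G (Δ ∪ Thompson.bitTranspositions) n)
      (asymmetry G (Δ ∪ Thompson.bitTranspositions) n)) ∧
    (∀ n : ℕ, IsGreatest (asymmetrySet G (Γ ∪ Thompson.bitTranspositions) n)
      (asymmetry G (Γ ∪ Thompson.bitTranspositions) n)) ∧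
    PolyEquiv (asymmetry G (Δ ∪ Thompson.bitTranspositions))
      (asymmetry G (Γ ∪ Thompson.bitTranspositions)) ∧
    (∃ c₀ c₁ : ℕ, 0 < c₀ ∧ 0 < c₁ ∧ ∀ n : ℕ,
      asymmetry G (Δ ∪ Thompson.bitTranspositions) n ≤
        c₀ * asymmetry G (Γ ∪ Thompson.bitTranspositions) (c₁ * n ^ 2)) ∧
    (∃ c₀' c₁' : ℕ, 0 < c₀' ∧ 0 < c₁' ∧ ∀ n : ℕ,
      asymmetry G (Γ ∪ Thompson.bitTranspositions) n ≤
        c₀' * asymmetry G (Δ ∪ Thompson.bitTranspositions) (c₁' * n) ^ 2) := by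
  have hGΓ (g) (hg : g ∈ G) := hΓ (Thompson.mem_lepM21_of_mem_lpG21 (hG hg))
  have hclosure : Submonoid.closure (Γ ∪ Thompson.bitTranspositions) ≤
      Submonoid.closure (Δ ∪ Thompson.bitTranspositions) :=
    Submonoid.closure_le.2
      (Set.union_subset hΔ (Set.subset_union_right.trans Submonoid.subset_closure))
  have hGΔ (g) (hg : g ∈ G) := hclosure (hGΓ g hg)
  have hbddΓ := Thompson.bddAbove_asymmetrySet hG hΓ_fin hGΓ
  have hbddΔ := Thompson.bddAbove_asymmetrySet hG hΔ_fin hGΔ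
  obtain ⟨C, hC, hquad⟩ :=
    Thompson.exists_wordLength_le_mul_sq Set.subset_union_right hΓ hΔ_fin
  obtain ⟨B, hB, hlin⟩ := exists_wordLength_union_le_mul hΓ_fin hΔ
  have hquadG (g) (hg : g ∈ G) := hquad g (hGΔ g hg) (hG hg).1.1 (hG hg).2
  have hlinG (g) (hg : g ∈ G) : wordLength (Δ ∪ Thompson.bitTranspositions) (g : Thompson.M21) ≤
      B * wordLength (Γ ∪ Thompson.bitTranspositions) (g : Thompson.M21) ^ 1 := by
    simpa only [pow_one] using hlin g (hGΓ g hg)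
  have hΔΓ := asymmetry_le_mul_pow hbddΓ hbddΔ hquadG hlinG
  have hΓΔ := asymmetry_le_mul_pow hbddΔ hbddΓ hlinG hquadG
  refine ⟨fun n => isGreatest_asymmetry (hbddΔ n), fun n => isGreatest_asymmetry (hbddΓ n),
    polyEquiv_of_le_mul_pow (asymmetry_mono hbddΔ) (asymmetry_mono hbddΓ) two_pos one_pos one_pos
      two_pos hΔΓ hΓΔ, ⟨B, C, hB, hC, ?_⟩, C, B, hC, hB, ?_⟩
  · simpa only [pow_one] using hΔΓ
  · simpa only [pow_one] using hΓΔ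

theorem mainTheorem7
    (Γlep ΓM : Set Thompson.M21) (hlep_fin : Γlep.Finite) (hM_fin : ΓM.Finite)
    (hlep : Submonoid.closure (Γlep ∪ Thompson.bitTranspositions) = Thompson.lepM21)
    (hM : Submonoid.closure ΓM = ⊤) :
    (∀ n : ℕ, IsGreatest
      (asymmetrySet Thompson.lpG21 (ΓM ∪ Thompson.bitTranspositions) n)
      (asymmetry Thompson.lpG21 (ΓM ∪ Thompson.bitTranspositions) n)) ∧
    (∀ n : ℕ, IsGreatest
      (asymmetrySet Thompson.lpG21 (Γlep ∪ Thompson.bitTranspositions) n)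
      (asymmetry Thompson.lpG21 (Γlep ∪ Thompson.bitTranspositions) n)) ∧
    PolyEquiv
      (asymmetry Thompson.lpG21 (ΓM ∪ Thompson.bitTranspositions))
      (asymmetry Thompson.lpG21 (Γlep ∪ Thompson.bitTranspositions)) ∧
    (∃ c₀ c₁ : ℕ, 0 < c₀ ∧ 0 < c₁ ∧ ∀ n : ℕ,
      asymmetry Thompson.lpG21 (ΓM ∪ Thompson.bitTranspositions) n ≤
        c₀ * asymmetry Thompson.lpG21 (Γlep ∪ Thompson.bitTranspositions) (c₁ * n ^ 2)) ∧
    (∃ c₀' c₁' : ℕ, 0 < c₀' ∧ 0 < c₁' ∧ ∀ n : ℕ,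
      asymmetry Thompson.lpG21 (Γlep ∪ Thompson.bitTranspositions) n ≤
        c₀' * asymmetry Thompson.lpG21 (ΓM ∪ Thompson.bitTranspositions) (c₁' * n) ^ 2) :=
  mainTheorem7_general le_rfl hlep_fin hM_fin hlep.ge fun _ _ =>
    Submonoid.closure_mono Set.subset_union_left (hM ▸ Submonoid.mem_top _)
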